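/- Let $\Gamma=\{(\xi_1,\xi_2)\in\mathbb R^2:\xi_1+\xi_2=0\}$, let $\hat f(\xi)=\int_{\mathbb R}f(x)e^{-2\pi i x\xi}\,dx$, let $\mathcal S(\mathbb R)$ be the complex-valued Schwartz functions on $\mathbb R$, and for bounded measurable $m:\mathbb R^2\to\mathbb C$ and $f_1,f_2\in\mathcal S(\mathbb R)$ put $$T_m(f_1,f_2)(x)=\int_{\mathbb R^2}m(\xi_1,\xi_2)\,\hat f_1(\xi_1)\,\hat f_2(\xi_2)\,e^{2\pi i x(\xi_1+\xi_2)}\,d\xi_1\,d\xi_2 .$$ There is an absolute $N\in\mathbb N$ such that the following holds. Let $m_0:\mathbb R^2\to\mathbb C$ be of class $C^N$ on $\mathbb R^2\setminus\Gamma$ and suppose that for every multi-index $\vec\alpha\in\mathbb N_0^2$ with $|\vec\alpha|\le N$ there is a constant $C_{\vec\alpha}$ with $|\partial^{\vec\alpha}m_0(\vec\xi)|\le C_{\vec\alpha}\,\mathrm{dist}(\vec\xi,\Gamma)^{-|\vec\alpha|}$ for all $\vec\xi$ (the bound being void when $\vec\xi\in\Gamma$ and $\vec\alpha\ne0$). Suppose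 also that there are constants $0<c\le C$ such that $m_0(\vec\xi)=0$ unless $c\le\mathrm{dist}(\vec\xi,\Gamma)\le C$. Let $1\le p_1\le\infty$ and $2<p_2<\infty$ satisfy $\frac1{p_1}+\frac1{p_2}<1$, and let $\frac1r=\frac1{p_1}+\frac1{p_2}$ and $\frac1{p_2}+\frac1{p_2'}=1$. Then there is a constant $K<\infty$, independent of $f_1,f_2$, such that for all $f_1,f_2\in\mathcal S(\mathbb R)$ we have $T_{m_0}(f_1,f_2)\in L^r(\mathbb R)$ and $$\|T_{m_0}(f_1,f_2)\|_{L^r(\mathbb R)}\le K\,\|f_1\|_{L^{p_1}(\mathbb R)}\,\|\hat f_2\|_{L^{p_2'}(\mathbb R)} .$$ -/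

import Mathlib

open MeasureTheory Real
open scoped ENNReal NNReal FourierTransform SchwartzMap

noncomputable section

/-- The degenerate line `ξ₁ + ξ₂ = 0` in the Euclidean plane. -/
def antidiagonal : Set (EuclideanSpace ℝ (Fin 2)) :=
  {ξ | ξ 0 + ξ 1 = 0}

/-- The mixed partial derivative `∂₁^a ∂₂^b m` at the point `ξ`. -/
def mixedPartial (a b : ℕ) (m : EuclideanSpace ℝ (Fin 2) → ℂ)
    (ξ : EuclideanSpace ℝ (Fin 2)) : ℂ :=
  iteratedDeriv a (fun s : ℝ => iteratedDeriv b (fun t : ℝ => m !₂[s, t]) (ξ 1)) (ξ 0)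

/-- Symbols `m` satisfying `|∂^α m(ξ)| ≤ C_α / dist(ξ, Γ)^|α|` for all multi-indices `α` with
`|α| ≤ N`, where `Γ` is the line `ξ₁ + ξ₂ = 0`. The bound is written in product form because the
right-hand side is infinite for `ξ ∈ Γ`, `α ≠ 0`; the derivatives are classical off `Γ`. -/
def IsSymbol (N : ℕ) (m : EuclideanSpace ℝ (Fin 2) → ℂ) : Prop :=
  ContDiffOn ℝ N m antidiagonalᶜ ∧
    ∀ a b : ℕ, a + b ≤ N → ∃ C : ℝ, ∀ ξ : EuclideanSpace ℝ (Fin 2),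
      Metric.infDist ξ antidiagonal ^ (a + b) * ‖mixedPartial a b m ξ‖ ≤ C

/-- The symbol `m` is supported where the distance to the line `ξ₁ + ξ₂ = 0` is comparable to
`1`, that is, lies between two positive constants. -/
def SupportedAtUnitDistance (m : EuclideanSpace ℝ (Fin 2) → ℂ) : Prop :=
  ∃ c C : ℝ, 0 < c ∧ ∀ ξ ∈ Function.support m,
    c ≤ Metric.infDist ξ antidiagonal ∧ Metric.infDist ξ antidiagonal ≤ C

/-- The bilinear multiplier operator
`T_m(f₁, f₂)(x) = ∫ m(ξ₁, ξ₂) f̂₁(ξ₁) f̂₂(ξ₂) e^{2πix(ξ₁ + ξ₂)} dξ₁ dξ₂`. -/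
def bilinearMultiplier (m : EuclideanSpace ℝ (Fin 2) → ℂ) (f₁ f₂ : 𝓢(ℝ, ℂ)) (x : ℝ) : ℂ :=
  ∫ ξ : EuclideanSpace ℝ (Fin 2),
    m ξ * 𝓕 (f₁ : ℝ → ℂ) (ξ 0) * 𝓕 (f₂ : ℝ → ℂ) (ξ 1) *
      Complex.exp (2 * π * Complex.I * x * (ξ 0 + ξ 1))

/-- The norm `‖f‖_{W_p} = ‖f̂‖_{L^{p'}}`, with `p'` the conjugate exponent of `p`. -/
def wNorm (p : ℝ≥0∞) (f : 𝓢(ℝ, ℂ)) : ℝ≥0∞ :=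
  eLpNorm (𝓕 (f : ℝ → ℂ)) (ENNReal.conjExponent p) volume

/-- The mixed estimate `L^{p₁} × W_{p₂} → L^r`, `1/r = 1/p₁ + 1/p₂`, for an operator defined on
pairs of Schwartz functions. -/
def MixedEstimate (T : 𝓢(ℝ, ℂ) → 𝓢(ℝ, ℂ) → ℝ → ℂ) (p₁ p₂ : ℝ≥0∞) : Prop :=
  ∃ C : ℝ≥0, ∀ f₁ f₂ : 𝓢(ℝ, ℂ),
    MemLp (T f₁ f₂) (p₁⁻¹ + p₂⁻¹)⁻¹ volume ∧
      eLpNorm (T f₁ f₂) (p₁⁻¹ + p₂⁻¹)⁻¹ volume ≤ C * eLpNorm f₁ p₁ volume * wNorm p₂ f₂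

end

/-! Write `q` for the conjugate exponent of `p = p₂`. The variables of the symbol are separated by a
one-parameter superposition. Since `e^t (m + ∂₂m)(s, t)` is the `t`-derivative of `e^t m(s, t)`, the
symbol `m(s, ξ)` is the integral over `t` of `a_t(s) E(ξ - t)`, with `a_t = (m + ∂₂m)(·, t)`
(`bumpFamily`) and `E` the one-sided exponential (`expTail`). Hence `T_m(f₁, f₂)(x)` is the integral
over `t` of a linear multiplier `a_t` applied to `f₁`, times the inverse Fourier transform of `f̂₂
E(· - t)` (`bilinearMultiplier_eq_integral`). Because the support of `m` stays near the line, `a_t`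
is a uniformly smooth bump at distance at most `L` from `-t`.

For fixed `x`, Hölder in `t` with exponents `p` and `q` splits the two factors. The `L^p_t` norm of
the first is at most a constant times `W(x)^(1/q)`, where `W` is the average of `|f₁|^q` against `1
/ (1 + (y - x)^2)` (`IsBumpFamily.lintegral_integral_rpow_le`). This interpolates between a trivial
`L¹ → L^∞` kernel bound and an `L²` bound from the bounded overlap of the bumps. The `L^p_x L^q_t`
norm of the second is controlled by the `L^q` norm of `f̂₂`, by Minkowski (`q ≤ p`) and
Hausdorff–Young for each `t` (`lintegral_lintegral_fourier_expTail_le`).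

Hölder in `x` finishes: `W` is bounded on `L^(p₁/q)` as soon as `p₁ ≥ q`, which follows from `1/p₁ +
1/p₂ < 1`. -/

/-! ### Interpolation by truncation -/

/-- The constant in the interpolation between the bounds `L¹ → L^∞` (with norm `A₁`) and
`L² → L²` (with norm `A₂ ^ (1 / 2)`). -/
noncomputable def interpolationConst (p A₁ A₂ : ℝ) : ℝ :=
  p * (4 * A₂ * ((2 * A₁) ^ (p - 2) / (p - 2)))

/-- Conjugacy gives `(p - 1)(q - 1) = 1`, so the hypothesis says that `γ ^ (q - 1)` exceeds `c`.
With `c` replaced by `c / t`, it controls the large part of a function in `L¹` by its `L^q` norm. -/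
lemma mul_le_rpow_of_rpow_lt {p q c γ : ℝ} (hpq : p.HolderConjugate q) (hc : 0 ≤ c)
    (h : c ^ (p - 1) < γ) : c * γ ≤ γ ^ q := by
  have hγ : 0 < γ := (rpow_nonneg hc _).trans_lt h
  have hp1 : 0 < p - 1 := sub_pos.2 hpq.lt
  have hq1 : 0 < q - 1 := sub_pos.2 hpq.symm.lt
  have hpq1 : (p - 1) * (q - 1) = 1 := by
    have := hpq.mul_eq_add
    linarith [show (p - 1) * (q - 1) = p * q - p - q + 1 by ring]
  have h1 : c ≤ γ ^ (q - 1) := by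
    calc c = (c ^ (p - 1)) ^ (q - 1) := by rw [← rpow_mul hc, hpq1, rpow_one]
      _ ≤ γ ^ (q - 1) := rpow_le_rpow (rpow_nonneg hc _) h.le hq1.le
  calc c * γ ≤ γ ^ (q - 1) * γ := by gcongr
    _ = γ ^ q := by
      rw [← rpow_add_one hγ.ne']; congr 1; ring

lemma setLIntegral_Ioc_rpow {s R : ℝ} (hs : -1 < s) (hR : 0 ≤ R) :
    ∫⁻ t in Set.Ioc 0 R, ENNReal.ofReal (t ^ s) = ENNReal.ofReal (R ^ (s + 1) / (s + 1)) := by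
  rw [← ofReal_integral_eq_lintegral_ofReal]
  · rw [← intervalIntegral.integral_of_le hR, integral_rpow (Or.inl hs),
      zero_rpow (by linarith), sub_zero]
  · exact (intervalIntegrable_iff_integrableOn_Ioc_of_le hR).1
      (intervalIntegral.intervalIntegrable_rpow' hs)
  · filter_upwards [ae_restrict_mem measurableSet_Ioc] with t ht
    exact rpow_nonneg ht.1.le _

/-- The condition on `t` amounts to `t ≤ c γ ^ (-1/(p-1))`, and `t ^ (p - 3)` is integrable at `0`
because `p > 2`. The powers of `γ` combine to `2 - (p-2)/(p-1) = q`. -/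
lemma setLIntegral_truncation_le {p q c γ : ℝ} (hpq : p.HolderConjugate q) (hp : 2 < p)
    (hc : 0 ≤ c) (hγ : 0 ≤ γ) :
    ∫⁻ t in Set.Ioi (0 : ℝ), Set.indicator {t : ℝ | γ ≤ (c / t) ^ (p - 1)}
        (fun t => ENNReal.ofReal (γ ^ 2) * ENNReal.ofReal (t ^ (p - 3))) t
      ≤ ENNReal.ofReal (c ^ (p - 2) / (p - 2)) * ENNReal.ofReal (γ ^ q) := by
  have hp1 : 0 < p - 1 := by linarith
  rcases hγ.eq_or_lt with rfl | hγ
  · simp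
  set R : ℝ := c * γ ^ (-(1 / (p - 1))) with hRdef
  have hR : 0 ≤ R := by positivity
  calc _ ≤ ∫⁻ t in Set.Ioi (0 : ℝ), Set.indicator (Set.Ioc 0 R)
        (fun t => ENNReal.ofReal (γ ^ 2) * ENNReal.ofReal (t ^ (p - 3))) t := by
        refine setLIntegral_mono' measurableSet_Ioi fun t ht => ?_
        by_cases h : γ ≤ (c / t) ^ (p - 1)
        · have ht : 0 < t := ht
          have h1 : γ ^ (1 / (p - 1)) ≤ c / t := by
            have := rpow_le_rpow hγ.le h (by positivity : 0 ≤ 1 / (p - 1))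
            rwa [← rpow_mul (by positivity), mul_one_div_cancel hp1.ne', rpow_one] at this
          have h2 : t ∈ Set.Ioc 0 R := by
            refine ⟨ht, ?_⟩
            rw [hRdef, rpow_neg hγ.le, ← div_eq_mul_inv, le_div_iff₀ (by positivity)]
            rwa [le_div_iff₀ ht, mul_comm] at h1
          rw [Set.indicator_of_mem h2, Set.indicator_of_mem (by exact h)]
        · rw [Set.indicator_of_notMem (by exact h)]
          exact zero_le
    _ = ∫⁻ t in Set.Ioc 0 R, ENNReal.ofReal (γ ^ 2) * ENNReal.ofReal (t ^ (p - 3)) := by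
        rw [lintegral_indicator measurableSet_Ioc, Measure.restrict_restrict measurableSet_Ioc]
        congr 2
        exact Set.inter_eq_left.2 fun t ht => ht.1
    _ = _ := by
        rw [lintegral_const_mul' _ _ ENNReal.ofReal_ne_top,
          setLIntegral_Ioc_rpow (by linarith) hR, ← ENNReal.ofReal_mul (by positivity),
          ← ENNReal.ofReal_mul (by
            have : 0 < p - 2 := by linarith
            positivity)]
        congr 1
        have e : p - 3 + 1 = p - 2 := by ring
        rw [e, hRdef, mul_rpow hc (by positivity), ← rpow_mul hγ.le, ← rpow_natCast]
        have : γ ^ q = γ ^ ((2 : ℕ) : ℝ) * γ ^ (-(1 / (p - 1)) * (p - 2)) := by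
          rw [← rpow_add hγ, hpq.conjugate_eq]
          congr 1
          push_cast
          field_simp
          ring
        rw [this]
        ring

/-- A Marcinkiewicz argument for a single function `g`. `S A` stands for the operator applied to `g`
restricted to `A`, so only additivity under cutting `g` by level sets is needed. The level depends
on the total mass of `|g| ^ q`, chosen so that the large part contributes at most `t / 2`
everywhere; the small part is handled by Chebyshev and the `L²` bound. -/
theorem lintegral_rpow_le_of_truncation {α β : Type*} [MeasurableSpace α] [MeasurableSpace β]
    {μ : Measure α} [SFinite μ] {ν : Measure β} {p q A₁ A₂ : ℝ} (hpq : p.HolderConjugate q)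
    (hp : 2 < p) (hA₁ : 0 < A₁) (hA₂ : 0 < A₂) {g : α → ℂ} (hg : Measurable g)
    (S : Set α → β → ℂ) (hS : ∀ A, MeasurableSet A → AEMeasurable (S A) ν)
    (hadd : ∀ A, MeasurableSet A → ∀ y, S Set.univ y = S A y + S Aᶜ y)
    (h₁ : ∀ A, MeasurableSet A → ∀ y, ‖S A y‖ₑ ≤ ENNReal.ofReal A₁ * ∫⁻ x in A, ‖g x‖ₑ ∂μ)
    (h₂ : ∀ A, MeasurableSet A →
      ∫⁻ y, ‖S A y‖ₑ ^ 2 ∂ν ≤ ENNReal.ofReal A₂ * ∫⁻ x in A, ‖g x‖ₑ ^ 2 ∂μ) :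
    ∫⁻ y, ‖S Set.univ y‖ₑ ^ p ∂ν ≤
      ENNReal.ofReal (interpolationConst p A₁ A₂) * (∫⁻ x, ‖g x‖ₑ ^ q ∂μ) ^ (p - 1) := by
  have hp1 : 0 < p - 1 := by linarith
  have hp2 : 0 < p - 2 := by linarith
  have hp0 : 0 < p := by linarith
  have hq0 : 0 < q := hpq.symm.pos
  by_cases hfin : ∫⁻ x, ‖g x‖ₑ ^ q ∂μ = ∞
  · rw [hfin, ENNReal.top_rpow_of_pos hp1, ENNReal.mul_top]
    · exact le_top
    · rw [Ne, ENNReal.ofReal_eq_zero, not_le, interpolationConst]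
      positivity
  have hofReal : ∀ (s : ℝ), 0 ≤ s → ∀ z : ℂ, ‖z‖ₑ ^ s = ENNReal.ofReal (‖z‖ ^ s) := fun s hs z => by
    rw [← ofReal_norm, ENNReal.ofReal_rpow_of_nonneg (norm_nonneg _) hs]
  obtain ⟨M, hM⟩ : ∃ M, M = (∫⁻ x, ‖g x‖ₑ ^ q ∂μ).toReal := ⟨_, rfl⟩
  have hM' : ∫⁻ x, ‖g x‖ₑ ^ q ∂μ = ENNReal.ofReal M := by
    rw [hM, ENNReal.ofReal_toReal hfin]
  -- The case `M = 0` is separate because the truncation constant below must be positive.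
  rcases (hM ▸ ENNReal.toReal_nonneg : 0 ≤ M).eq_or_lt with hM0 | hM0
  · rw [← hM0, ENNReal.ofReal_zero, lintegral_eq_zero_iff (by fun_prop)] at hM'
    have hg0 : ∫⁻ x, ‖g x‖ₑ ∂μ = 0 := by
      rw [lintegral_eq_zero_iff (by fun_prop)]
      filter_upwards [hM'] with x hx
      simpa [hq0, hq0.not_gt, hq0.ne'] using hx
    have : ∀ y, ‖S Set.univ y‖ₑ = 0 := fun y => by
      have := h₁ Set.univ MeasurableSet.univ y
      rwa [Measure.restrict_univ, hg0, mul_zero, nonpos_iff_eq_zero] at this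
    simp [this, hp0]
  -- On `A t` one has `(c / t) |g| ≤ |g| ^ q`, so the `L¹` mass of `g` there is at most `M t / c = t
  -- / (2 A₁)`. This fixes `c`.
  set c := 2 * A₁ * M with hc
  have hc0 : 0 < c := by positivity
  let A : ℝ → Set α := fun t => {x | (c / t) ^ (p - 1) < ‖g x‖}
  have hA : ∀ t, MeasurableSet (A t) := fun t => measurableSet_lt measurable_const hg.norm
  have hsmall : ∀ t > 0, ∀ y, ‖S (A t) y‖ ≤ t / 2 := fun t ht y => by
    have hle : ENNReal.ofReal (c / t) * ∫⁻ x in A t, ‖g x‖ₑ ∂μ ≤ ENNReal.ofReal M := by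
      rw [← hM', ← lintegral_const_mul' _ _ ENNReal.ofReal_ne_top]
      refine (setLIntegral_mono' (hA t) fun x hx => ?_).trans (setLIntegral_le_lintegral _ _)
      rw [hofReal q hq0.le, ← ofReal_norm, ← ENNReal.ofReal_mul (by positivity)]
      exact ENNReal.ofReal_le_ofReal (mul_le_rpow_of_rpow_lt hpq (by positivity) hx)
    have hle2 : ∫⁻ x in A t, ‖g x‖ₑ ∂μ ≤ ENNReal.ofReal (t / (2 * A₁)) := by
      have : ∫⁻ x in A t, ‖g x‖ₑ ∂μ ≤ ENNReal.ofReal M / ENNReal.ofReal (c / t) := by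
        rw [ENNReal.le_div_iff_mul_le (Or.inl (by simp; positivity)) (Or.inl (by simp)), mul_comm]
        exact hle
      rw [← ENNReal.ofReal_div_of_pos (by positivity)] at this
      convert this using 2
      rw [hc]; field_simp
    have := (h₁ (A t) (hA t) y).trans (mul_le_mul_right hle2 _)
    rw [← ENNReal.ofReal_mul hA₁.le, ← ofReal_norm, ENNReal.ofReal_le_ofReal_iff (by positivity)]
      at this
    refine this.trans (le_of_eq ?_)
    field_simp
  have hlevel : ∀ t > 0, ν {y | t < ‖S Set.univ y‖} ≤
      ENNReal.ofReal (4 * A₂ / t ^ 2) * ∫⁻ x in (A t)ᶜ, ‖g x‖ₑ ^ 2 ∂μ := fun t ht => by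
    have hsub : {y | t < ‖S Set.univ y‖} ⊆
        {y | ENNReal.ofReal (t ^ 2 / 4) ≤ ‖S (A t)ᶜ y‖ₑ ^ 2} := fun y hy => by
      have h3 : ‖S Set.univ y‖ ≤ ‖S (A t) y‖ + ‖S (A t)ᶜ y‖ := by
        rw [hadd (A t) (hA t) y]; exact norm_add_le _ _
      have h4 : t / 2 ≤ ‖S (A t)ᶜ y‖ := by
        have := hsmall t ht y
        have hy' : t < ‖S Set.univ y‖ := hy
        linarith
      have h5 : t ^ 2 / 4 ≤ ‖S (A t)ᶜ y‖ ^ 2 := by nlinarith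
      rw [Set.mem_ofPred_eq, ← ofReal_norm, ← ENNReal.ofReal_pow (norm_nonneg _)]
      exact ENNReal.ofReal_le_ofReal h5
    refine (measure_mono hsub).trans ?_
    refine (meas_ge_le_lintegral_div
      ((hS _ (hA t).compl).enorm.pow_const 2) (by simp; positivity) (by simp)).trans ?_
    rw [ENNReal.div_eq_inv_mul, ← ENNReal.ofReal_inv_of_pos (by positivity)]
    refine (mul_le_mul_right (h₂ _ (hA t).compl) _).trans (le_of_eq ?_)
    rw [← mul_assoc, ← ENNReal.ofReal_mul (by positivity)]
    congr 2
    field_simp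
  have hF : Measurable (Function.uncurry fun (t : ℝ) (x : α) =>
      Set.indicator {t : ℝ | ‖g x‖ ≤ (c / t) ^ (p - 1)}
        (fun t => ENNReal.ofReal (‖g x‖ ^ 2) * ENNReal.ofReal (t ^ (p - 3))) t) := by
    have : (Function.uncurry fun (t : ℝ) (x : α) =>
      Set.indicator {t : ℝ | ‖g x‖ ≤ (c / t) ^ (p - 1)}
        (fun t => ENNReal.ofReal (‖g x‖ ^ 2) * ENNReal.ofReal (t ^ (p - 3))) t) =
        Set.indicator {z : ℝ × α | ‖g z.2‖ ≤ (c / z.1) ^ (p - 1)}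
        (fun z => ENNReal.ofReal (‖g z.2‖ ^ 2) * ENNReal.ofReal (z.1 ^ (p - 3))) := by
      ext ⟨t, x⟩
      simp [Set.indicator]
    rw [this]
    exact Measurable.indicator (by fun_prop) (measurableSet_le (by fun_prop) (by fun_prop))
  calc ∫⁻ y, ‖S Set.univ y‖ₑ ^ p ∂ν = ∫⁻ y, ENNReal.ofReal (‖S Set.univ y‖ ^ p) ∂ν := by
        simp_rw [hofReal p hp0.le]
    _ = ENNReal.ofReal p * ∫⁻ t in Set.Ioi 0,
          ν {y | t < ‖S Set.univ y‖} * ENNReal.ofReal (t ^ (p - 1)) :=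
        lintegral_rpow_eq_lintegral_meas_lt_mul ν (.of_forall fun _ => norm_nonneg _)
          (hS _ .univ).norm hp0
    _ ≤ ENNReal.ofReal p * ∫⁻ t in Set.Ioi 0, ENNReal.ofReal (4 * A₂) *
          ∫⁻ x, Set.indicator {t : ℝ | ‖g x‖ ≤ (c / t) ^ (p - 1)}
        (fun t => ENNReal.ofReal (‖g x‖ ^ 2) * ENNReal.ofReal (t ^ (p - 3))) t ∂μ := by
        gcongr ENNReal.ofReal p * ?_
        refine setLIntegral_mono' measurableSet_Ioi fun t ht => ?_
        have ht : 0 < t := ht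
        refine (mul_le_mul_left (hlevel t ht) _).trans (le_of_eq ?_)
        have e1 : ENNReal.ofReal (4 * A₂ / t ^ 2) * ENNReal.ofReal (t ^ (p - 1)) =
            ENNReal.ofReal (4 * A₂) * ENNReal.ofReal (t ^ (p - 3)) := by
          rw [← ENNReal.ofReal_mul (by positivity), ← ENNReal.ofReal_mul (by positivity)]
          congr 1
          have : t ^ (p - 1) = t ^ (p - 3) * t ^ 2 := by
            rw [← rpow_natCast, ← rpow_add ht]; congr 1; push_cast; ring
          rw [this]; field_simp
        rw [mul_right_comm, e1, mul_assoc, ← lintegral_const_mul' _ _ ENNReal.ofReal_ne_top,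
          ← lintegral_indicator (hA t).compl]
        congr 1
        refine lintegral_congr fun x => ?_
        have : x ∈ (A t)ᶜ ↔ ‖g x‖ ≤ (c / t) ^ (p - 1) := by simp [A]
        by_cases hx : ‖g x‖ ≤ (c / t) ^ (p - 1)
        · rw [Set.indicator_of_mem (this.2 hx), Set.indicator_of_mem (by exact hx), mul_comm,
            ← ofReal_norm, ENNReal.ofReal_pow (norm_nonneg _)]
        · rw [Set.indicator_of_notMem (fun h => hx (this.1 h)),
            Set.indicator_of_notMem (by exact hx)]
    _ = ENNReal.ofReal p * (ENNReal.ofReal (4 * A₂) * ∫⁻ x, (∫⁻ t in Set.Ioi (0 : ℝ),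
          Set.indicator {t : ℝ | ‖g x‖ ≤ (c / t) ^ (p - 1)}
        (fun t => ENNReal.ofReal (‖g x‖ ^ 2) * ENNReal.ofReal (t ^ (p - 3))) t) ∂μ) := by
        rw [lintegral_const_mul' _ _ ENNReal.ofReal_ne_top, lintegral_lintegral_swap hF.aemeasurable]
    _ ≤ ENNReal.ofReal p * (ENNReal.ofReal (4 * A₂) * ∫⁻ x,
          ENNReal.ofReal (c ^ (p - 2) / (p - 2)) * ‖g x‖ₑ ^ q ∂μ) := by
        gcongr with x
        rw [hofReal q hq0.le]
        exact setLIntegral_truncation_le hpq hp hc0.le (norm_nonneg _)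
    _ = _ := by
        rw [lintegral_const_mul' _ _ ENNReal.ofReal_ne_top, hM',
          ENNReal.ofReal_rpow_of_pos hM0, ← ENNReal.ofReal_mul (by positivity),
          ← ENNReal.ofReal_mul (by positivity), ← ENNReal.ofReal_mul (by positivity),
          ← ENNReal.ofReal_mul (by unfold interpolationConst; positivity)]
        congr 1
        have : M ^ (p - 1) = M ^ (p - 2) * M := by
          rw [← rpow_add_one hM0.ne']; congr 1; ring
        rw [this, interpolationConst, hc, mul_rpow (by positivity) hM0.le]
        ring

/-! ### Plancherel and Hausdorff–Young -/

/-- Tested against a smooth compactly supported function, both transforms move onto the test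
function: one by the definition of the distributional transform, the other by the multiplication
formula. -/
lemma fourier_toLp_two_ae_eq {g : ℝ → ℂ} (hg₁ : Integrable g) (hg₂ : MemLp g 2) :
    𝓕 g =ᵐ[volume] (𝓕 (hg₂.toLp g) : Lp ℂ 2 (volume : Measure ℝ)) := by
  have hcont : Continuous (𝓕 g) :=
    VectorFourier.fourierIntegral_continuous continuous_fourierChar
      (by exact continuous_inner) hg₁
  refine ae_eq_of_integral_contDiff_smul_eq hcont.locallyIntegrable
    ((Lp.memLp _).locallyIntegrable one_le_two) fun φ hφ hφc => ?_
  have hc : HasCompactSupport (fun x => (φ x : ℂ)) := hφc.comp_left Complex.ofReal_zero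
  let Φ : 𝓢(ℝ, ℂ) := hc.toSchwartzMap (Complex.ofRealCLM.contDiff.comp hφ)
  have hΦ : ∀ x, Φ x = φ x := fun _ => rfl
  have h1 : ∫ x, φ x • (𝓕 (hg₂.toLp g) : Lp ℂ 2 (volume : Measure ℝ)) x =
      ∫ x, (𝓕 Φ) x • (hg₂.toLp g) x := by
    have := congrArg (fun T => T Φ) (Lp.fourier_toTemperedDistribution_eq (hg₂.toLp g))
    simp only [TemperedDistribution.fourier_apply, Lp.toTemperedDistribution_apply] at this
    rw [this]
    refine integral_congr_ae (.of_forall fun x => ?_)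
    simp [hΦ]
  rw [h1]
  have h2 : ∫ x, (𝓕 Φ) x • (hg₂.toLp g) x = ∫ x, 𝓕 (Φ : ℝ → ℂ) x • g x := by
    refine integral_congr_ae ?_
    filter_upwards [hg₂.coeFn_toLp] with x hx
    rw [hx, SchwartzMap.fourier_coe]
  rw [h2]
  have h3 := VectorFourier.integral_fourierIntegral_smul_eq_flip (μ := (volume : Measure ℝ))
    (ν := (volume : Measure ℝ)) (L := innerₗ ℝ) continuous_fourierChar
      (by exact continuous_inner) Φ.integrable hg₁
  simp only [flip_innerₗ] at h3
  refine Eq.trans ?_ h3.symm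
  refine integral_congr_ae (.of_forall fun x => ?_)
  simp only [hΦ, Complex.real_smul, smul_eq_mul]
  rfl

/-- Plancherel's identity for the Fourier integral of a function in `L¹ ∩ L²`. -/
theorem lintegral_enorm_fourier_sq {g : ℝ → ℂ} (hg₁ : Integrable g) (hg₂ : MemLp g 2) :
    ∫⁻ x, ‖𝓕 g x‖ₑ ^ 2 = ∫⁻ x, ‖g x‖ₑ ^ 2 := by
  have key : ∀ h : ℝ → ℂ, eLpNorm h 2 volume ^ 2 = ∫⁻ x, ‖h x‖ₑ ^ 2 := fun h => by
    rw [eLpNorm_eq_lintegral_rpow_enorm_toReal two_ne_zero ENNReal.ofNat_ne_top,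
      ← ENNReal.rpow_natCast, ← ENNReal.rpow_mul]
    simp
  rw [← key, ← key, eLpNorm_congr_ae (fourier_toLp_two_ae_eq hg₁ hg₂),
    ← eLpNorm_congr_ae hg₂.coeFn_toLp, ← Lp.enorm_def, ← Lp.enorm_def, ← ofReal_norm,
    ← ofReal_norm, Lp.norm_fourier_eq]

lemma continuous_fourier {g : ℝ → ℂ} (hg : Integrable g) : Continuous (𝓕 g) :=
  VectorFourier.fourierIntegral_continuous continuous_fourierChar (by exact continuous_inner) hg

lemma enorm_fourier_le (g : ℝ → ℂ) (x : ℝ) : ‖𝓕 g x‖ₑ ≤ ∫⁻ y, ‖g y‖ₑ := by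
  rw [Real.fourier_eq]
  refine (enorm_integral_le_lintegral_enorm _).trans (le_of_eq (lintegral_congr fun y => ?_))
  rw [← ofReal_norm, Circle.norm_smul, ofReal_norm]

lemma fourier_add_of_integrable {f g : ℝ → ℂ} (hf : Integrable f) (hg : Integrable g) (x : ℝ) :
    𝓕 (f + g) x = 𝓕 f x + 𝓕 g x :=
  congrFun (VectorFourier.fourierIntegral_add (L := innerₗ ℝ) continuous_fourierChar
    (by exact continuous_inner) hf hg) x

/-- The Hausdorff–Young inequality. -/
theorem lintegral_enorm_fourier_rpow_le {p q : ℝ} (hpq : p.HolderConjugate q) (hp : 2 < p)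
    {g : ℝ → ℂ} (hg : Measurable g) (hg₁ : Integrable g) (hg₂ : MemLp g 2) :
    ∫⁻ x, ‖𝓕 g x‖ₑ ^ p ≤
      ENNReal.ofReal (interpolationConst p 1 1) * (∫⁻ x, ‖g x‖ₑ ^ q) ^ (p - 1) := by
  have := lintegral_rpow_le_of_truncation (μ := volume) (ν := volume) hpq hp one_pos one_pos hg
    (fun A => 𝓕 (A.indicator g))
    (fun A hA => (continuous_fourier (hg₁.indicator hA)).measurable.aemeasurable)
    (fun A hA y => by
      rw [← fourier_add_of_integrable (hg₁.indicator hA) (hg₁.indicator hA.compl),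
        Set.indicator_self_add_compl, Set.indicator_univ])
    (fun A hA y => by
      rw [ENNReal.ofReal_one, one_mul, ← lintegral_indicator hA]
      simp_rw [← enorm_indicator_eq_indicator_enorm]
      exact enorm_fourier_le _ _)
    (fun A hA => by
      rw [ENNReal.ofReal_one, one_mul, ← lintegral_indicator hA,
        lintegral_enorm_fourier_sq (hg₁.indicator hA) (hg₂.indicator hA)]
      refine le_of_eq (lintegral_congr fun x => ?_)
      by_cases hx : x ∈ A <;> simp [hx])
  simpa using this

/-! ### Bump families and their Fourier kernels -/

lemma fourier_mul_fourierChar (h : ℝ → ℂ) (x y : ℝ) :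
    𝓕 (fun s => h s * Complex.exp (2 * π * Complex.I * x * s)) y = 𝓕 h (y - x) := by
  rw [Real.fourier_real_eq_integral_exp_smul, Real.fourier_real_eq_integral_exp_smul]
  refine integral_congr_ae (.of_forall fun s => ?_)
  simp only [smul_eq_mul]
  rw [mul_left_comm, ← Complex.exp_add, mul_comm]
  congr 2
  push_cast
  ring

lemma norm_cexp_two_pi_I_mul (x s : ℝ) : ‖Complex.exp (2 * π * Complex.I * x * s)‖ = 1 := by
  rw [show (2 * π * Complex.I * x * s : ℂ) = ((2 * π * x * s : ℝ) : ℂ) * Complex.I by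
    push_cast; ring, Complex.norm_exp_ofReal_mul_I]

lemma integrable_mul_cexp {h : ℝ → ℂ} (hh : Integrable h) (x : ℝ) :
    Integrable (fun s => h s * Complex.exp (2 * π * Complex.I * x * s)) := by
  refine hh.mul_bdd (c := 1) (by fun_prop) (.of_forall fun s => ?_)
  rw [norm_cexp_two_pi_I_mul]

/-- The multiplication formula `∫ f ĥ = ∫ f̂ h` for a modulated `h`; it turns the kernel form of a
Fourier multiplier into its frequency form. -/
lemma integral_mul_fourier_sub {f h : ℝ → ℂ} (hf : Integrable f) (hh : Integrable h) (x : ℝ) :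
    ∫ y, f y * 𝓕 h (y - x) =
      ∫ s, 𝓕 f s * (h s * Complex.exp (2 * π * Complex.I * x * s)) := by
  have h3 := VectorFourier.integral_fourierIntegral_smul_eq_flip (μ := (volume : Measure ℝ))
    (ν := (volume : Measure ℝ)) (L := innerₗ ℝ) continuous_fourierChar
      (by exact continuous_inner) hf (integrable_mul_cexp hh x)
  simp only [flip_innerₗ] at h3
  refine Eq.trans ?_ h3.symm
  refine integral_congr_ae (.of_forall fun y => ?_)
  simp only [smul_eq_mul, ← fourier_mul_fourierChar]
  rfl

/-- A family of `C²` bumps, `a t` being supported within distance `L` of `-t`, with uniformly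
bounded derivatives. -/
structure IsBumpFamily (a : ℝ → ℝ → ℂ) (B L : ℝ) : Prop where
  B_pos : 0 < B
  L_pos : 0 < L
  contDiff : ∀ t, ContDiff ℝ 2 (a t)
  continuous : Continuous (Function.uncurry a)
  bound : ∀ j ≤ 2, ∀ t s, ‖iteratedDeriv j (a t) s‖ ≤ B
  supp : ∀ t s, a t s ≠ 0 → |s + t| ≤ L

namespace IsBumpFamily

variable {a : ℝ → ℝ → ℂ} {B L : ℝ}

lemma tsupport_iteratedDeriv_subset (ha : IsBumpFamily a B L) (j : ℕ) (t : ℝ) :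
    tsupport (iteratedDeriv j (a t)) ⊆ Metric.closedBall (-t) L := by
  have h0 : tsupport (a t) ⊆ Metric.closedBall (-t) L := by
    refine closure_minimal (fun s hs => ?_) Metric.isClosed_closedBall
    rw [Metric.mem_closedBall, Real.dist_eq, sub_neg_eq_add]
    exact ha.supp t s hs
  induction j with
  | zero => simpa using h0
  | succ j ih =>
    rw [iteratedDeriv_succ]
    exact (tsupport_deriv_subset).trans ih

lemma norm_iteratedDeriv_le (ha : IsBumpFamily a B L) {j : ℕ} (hj : j ≤ 2) (t s : ℝ) :
    ‖iteratedDeriv j (a t) s‖ ≤ (Metric.closedBall (-t) L).indicator (fun _ => B) s := by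
  by_cases hs : s ∈ Metric.closedBall (-t) L
  · rw [Set.indicator_of_mem hs]
    exact ha.bound j hj t s
  · rw [Set.indicator_of_notMem hs, image_eq_zero_of_notMem_tsupport
      (fun h => hs (ha.tsupport_iteratedDeriv_subset j t h)), norm_zero]

lemma integrable_iteratedDeriv (ha : IsBumpFamily a B L) {j : ℕ} (hj : j ≤ 2) (t : ℝ) :
    Integrable (iteratedDeriv j (a t)) :=
  ((ha.contDiff t).continuous_iteratedDeriv j (by exact_mod_cast hj)).integrable_of_hasCompactSupport
    ((isCompact_closedBall _ _).of_isClosed_subset (isClosed_tsupport _)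
      (ha.tsupport_iteratedDeriv_subset j t))

lemma integrable (ha : IsBumpFamily a B L) (t : ℝ) : Integrable (a t) := by
  simpa using ha.integrable_iteratedDeriv (Nat.zero_le 2) t

lemma integrable_deriv (ha : IsBumpFamily a B L) (t : ℝ) : Integrable (deriv (a t)) := by
  simpa using ha.integrable_iteratedDeriv (j := 1) (by norm_num) t

lemma norm_fourier_iteratedDeriv_le (ha : IsBumpFamily a B L) {j : ℕ} (hj : j ≤ 2) (t z : ℝ) :
    ‖𝓕 (iteratedDeriv j (a t)) z‖ ≤ 2 * L * B := by
  have h1 : ‖𝓕 (iteratedDeriv j (a t)) z‖ ≤ ∫ s, ‖iteratedDeriv j (a t) s‖ :=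
    VectorFourier.norm_fourierIntegral_le_integral_norm _ _ _ _ _
  refine h1.trans ((integral_mono (ha.integrable_iteratedDeriv hj t).norm ?_
    (ha.norm_iteratedDeriv_le hj t)).trans (le_of_eq ?_))
  · exact (integrable_indicator_iff Metric.isClosed_closedBall.measurableSet).2
      (integrableOn_const measure_closedBall_lt_top.ne)
  · rw [integral_indicator Metric.isClosed_closedBall.measurableSet, setIntegral_const,
      measureReal_def, Real.volume_closedBall, ENNReal.toReal_ofReal (by linarith [ha.L_pos]),
      smul_eq_mul]

/-- The transforms of `a t` and of its second derivative are both at most `2 L B`; adding the two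
bounds, with `4π² ≥ 1`, gives the decay. -/
lemma norm_fourier_le (ha : IsBumpFamily a B L) (t z : ℝ) :
    ‖𝓕 (a t) z‖ ≤ 4 * L * B * (1 + z ^ 2)⁻¹ := by
  have h0 := ha.norm_fourier_iteratedDeriv_le (Nat.zero_le 2) t z
  have h2 := ha.norm_fourier_iteratedDeriv_le le_rfl t z
  rw [iteratedDeriv_zero] at h0
  rw [Real.fourier_iteratedDeriv (N := 2) (ha.contDiff t)
    (fun n hn => ha.integrable_iteratedDeriv (by exact_mod_cast hn) t) le_rfl] at h2
  have e : ‖((2 * π * Complex.I * z) ^ 2 • 𝓕 (a t) z : ℂ)‖ = 4 * π ^ 2 * z ^ 2 * ‖𝓕 (a t) z‖ := by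
    rw [norm_smul, norm_pow]
    simp only [norm_mul, Complex.norm_real, Complex.norm_I, norm_eq_abs, abs_of_pos pi_pos,
      RCLike.norm_ofNat, mul_one, mul_pow, sq_abs]
    ring
  rw [e] at h2
  rw [← div_eq_mul_inv, le_div_iff₀ (by positivity)]
  have hπ : 1 ≤ 4 * π ^ 2 := by nlinarith [pi_gt_three]
  have : z ^ 2 * ‖𝓕 (a t) z‖ ≤ 4 * π ^ 2 * z ^ 2 * ‖𝓕 (a t) z‖ := by
    have : 0 ≤ z ^ 2 * ‖𝓕 (a t) z‖ := by positivity
    nlinarith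
  nlinarith

/-- The factor `1 + 2πiz` never vanishes, so it can be divided out of `f`. This trades one
derivative of the bump for a decaying weight on `f`. -/
lemma fourier_add_deriv (ha : IsBumpFamily a B L) (t z : ℝ) :
    𝓕 (a t + deriv (a t)) z = (1 + 2 * π * Complex.I * z) * 𝓕 (a t) z := by
  rw [fourier_add_of_integrable (ha.integrable t) (ha.integrable_deriv t),
    Real.fourier_deriv (ha.integrable t) ((ha.contDiff t).differentiable two_ne_zero)
      (ha.integrable_deriv t)]
  simp only [smul_eq_mul]
  ring

lemma norm_add_deriv_le (ha : IsBumpFamily a B L) (t s : ℝ) :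
    ‖(a t + deriv (a t)) s‖ ≤ (Metric.closedBall (-t) L).indicator (fun _ => 2 * B) s := by
  have h0 := ha.norm_iteratedDeriv_le (Nat.zero_le 2) t s
  have h1 := ha.norm_iteratedDeriv_le (j := 1) (by norm_num) t s
  rw [iteratedDeriv_zero] at h0
  rw [iteratedDeriv_one] at h1
  refine (norm_add_le _ _).trans ((add_le_add h0 h1).trans (le_of_eq ?_))
  by_cases hs : s ∈ Metric.closedBall (-t) L <;> simp [hs, two_mul]

/-- The almost orthogonality of the operators with kernels `𝓕 (a t) (y - x)`. -/
lemma lintegral_integral_sq_le (ha : IsBumpFamily a B L) {f : ℝ → ℂ} (hf : Integrable f)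
    (hf₂ : MemLp f 2) (x : ℝ) :
    ∫⁻ t, ‖∫ y, f y * 𝓕 (a t) (y - x)‖ₑ ^ 2 ≤
      ENNReal.ofReal (16 * B ^ 2 * L ^ 2) *
        ∫⁻ y, ‖f y‖ₑ ^ 2 * ENNReal.ofReal ((1 + (y - x) ^ 2)⁻¹) := by
  -- The weight `|d|⁻²` is dominated by `1 / (1 + (y - x)^2)`. Replacing `f` by `ψ = f / d` and `a
  -- t` by `a t + deriv (a t)` leaves the integral unchanged.
  let d : ℝ → ℂ := fun y => 1 + 2 * π * Complex.I * ((y - x : ℝ) : ℂ)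
  have hd : ∀ y, ‖d y‖ ^ 2 = 1 + (2 * π * (y - x)) ^ 2 := fun y => by
    rw [← Complex.normSq_eq_norm_sq, Complex.normSq_apply]
    simp [d]
    ring
  have hd1 : ∀ y, 1 + (y - x) ^ 2 ≤ ‖d y‖ ^ 2 := fun y => by
    rw [hd, mul_pow]
    have hπ : 1 ≤ (2 * π) ^ 2 := by nlinarith [pi_gt_three]
    nlinarith [sq_nonneg (y - x)]
  have hd0 : ∀ y, d y ≠ 0 := fun y h => by
    have := hd1 y
    rw [h, norm_zero] at this
    nlinarith [sq_nonneg (y - x)]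
  have hdm : Continuous d := by fun_prop
  have hdinv : ∀ y, ‖(d y)⁻¹‖ ≤ 1 := fun y => by
    rw [norm_inv]
    refine inv_le_one_of_one_le₀ ?_
    have := hd1 y
    nlinarith [sq_nonneg (y - x), norm_nonneg (d y)]
  have hdinvm : Continuous fun y => (d y)⁻¹ := hdm.inv₀ hd0
  let ψ : ℝ → ℂ := fun y => (d y)⁻¹ * f y
  have hψ : Integrable ψ := hf.bdd_mul hdinvm.aestronglyMeasurable (.of_forall hdinv)
  have hψ₂ : MemLp ψ 2 := by
    refine hf₂.of_le (hdinvm.aestronglyMeasurable.mul hf.1) (.of_forall fun y => ?_)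
    rw [norm_mul]
    exact mul_le_of_le_one_left (norm_nonneg _) (hdinv y)
  have hrep : ∀ t, ∫ y, f y * 𝓕 (a t) (y - x) = ∫ s, 𝓕 ψ s *
      ((a t + deriv (a t)) s * Complex.exp (2 * π * Complex.I * x * s)) := fun t => by
    rw [← integral_mul_fourier_sub hψ ((ha.integrable t).add (ha.integrable_deriv t))]
    refine integral_congr_ae (.of_forall fun y => ?_)
    simp only [ha.fourier_add_deriv, ψ]
    field_simp [hd0 y]
    rfl
  have hbd : ∀ t, ‖∫ y, f y * 𝓕 (a t) (y - x)‖ₑ ^ 2 ≤ ENNReal.ofReal (8 * B ^ 2 * L) *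
      ∫⁻ s, (Metric.closedBall (-t) L).indicator (fun s => ‖𝓕 ψ s‖ₑ ^ 2) s := fun t => by
    have h1 : ‖∫ y, f y * 𝓕 (a t) (y - x)‖ₑ ≤ ENNReal.ofReal (2 * B) *
        ∫⁻ s in Metric.closedBall (-t) L, ‖𝓕 ψ s‖ₑ := by
      rw [hrep, ← lintegral_const_mul' _ _ ENNReal.ofReal_ne_top,
        ← lintegral_indicator Metric.isClosed_closedBall.measurableSet]
      refine (enorm_integral_le_lintegral_enorm _).trans (lintegral_mono fun s => ?_)
      have hn : ‖Complex.exp (2 * π * Complex.I * x * s)‖ₑ = 1 := by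
        rw [← ofReal_norm, norm_cexp_two_pi_I_mul, ENNReal.ofReal_one]
      rw [enorm_mul, enorm_mul, hn, mul_one]
      have := ha.norm_add_deriv_le t s
      by_cases hs : s ∈ Metric.closedBall (-t) L
      · rw [Set.indicator_of_mem hs] at this ⊢
        rw [mul_comm]
        gcongr
        rw [← ofReal_norm]
        exact ENNReal.ofReal_le_ofReal this
      · rw [Set.indicator_of_notMem hs] at this ⊢
        rw [norm_le_zero_iff.1 this]
        simp
    -- Cauchy–Schwarz on an interval of length `2 L`.
    have h2 : (∫⁻ s in Metric.closedBall (-t) L, ‖𝓕 ψ s‖ₑ) ^ 2 ≤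
        ENNReal.ofReal (2 * L) * ∫⁻ s in Metric.closedBall (-t) L, ‖𝓕 ψ s‖ₑ ^ 2 := by
      have := ENNReal.lintegral_mul_le_Lp_mul_Lq
        (volume.restrict (Metric.closedBall (-t) L)) Real.HolderConjugate.two_two
        (f := fun s => ‖𝓕 ψ s‖ₑ) (g := fun _ => 1)
        (continuous_fourier hψ).enorm.aemeasurable aemeasurable_const
      simp only [Pi.mul_apply, mul_one, ENNReal.one_rpow, lintegral_one, Measure.restrict_apply_univ,
        Real.volume_closedBall] at this
      calc _ ≤ _ := pow_le_pow_left' this 2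
        _ = _ := by
          rw [mul_pow, ← ENNReal.rpow_natCast, ← ENNReal.rpow_natCast, ← ENNReal.rpow_mul,
            ← ENNReal.rpow_mul, mul_comm]
          norm_num
    calc _ ≤ (ENNReal.ofReal (2 * B) * ∫⁻ s in Metric.closedBall (-t) L, ‖𝓕 ψ s‖ₑ) ^ 2 :=
          pow_le_pow_left' h1 2
      _ ≤ ENNReal.ofReal (2 * B) ^ 2 *
          (ENNReal.ofReal (2 * L) * ∫⁻ s in Metric.closedBall (-t) L, ‖𝓕 ψ s‖ₑ ^ 2) := by
          rw [mul_pow]; gcongr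
      _ = _ := by
          rw [lintegral_indicator Metric.isClosed_closedBall.measurableSet, ← mul_assoc,
            ← ENNReal.ofReal_pow (by linarith [ha.B_pos]),
            ← ENNReal.ofReal_mul (by positivity)]
          congr 2
          ring
  have hcl : MeasurableSet {z : ℝ × ℝ | z.2 ∈ Metric.closedBall (-z.1) L} := by
    simp only [Metric.mem_closedBall]
    exact measurableSet_le (by fun_prop) measurable_const
  have hmeas : Measurable (Function.uncurry fun (t s : ℝ) =>
      (Metric.closedBall (-t) L).indicator (fun s => ‖𝓕 ψ s‖ₑ ^ 2) s) := by
    have : (Function.uncurry fun (t s : ℝ) =>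
      (Metric.closedBall (-t) L).indicator (fun s => ‖𝓕 ψ s‖ₑ ^ 2) s) =
        {z : ℝ × ℝ | z.2 ∈ Metric.closedBall (-z.1) L}.indicator (fun z => ‖𝓕 ψ z.2‖ₑ ^ 2) := by
      ext ⟨t, s⟩
      simp [Set.indicator]
    rw [this]
    refine Measurable.indicator ?_ hcl
    have := (continuous_fourier hψ).measurable
    fun_prop
  calc _ ≤ ∫⁻ t, ENNReal.ofReal (8 * B ^ 2 * L) *
      ∫⁻ s, (Metric.closedBall (-t) L).indicator (fun s => ‖𝓕 ψ s‖ₑ ^ 2) s := lintegral_mono hbd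
    _ = ENNReal.ofReal (8 * B ^ 2 * L) * ∫⁻ s, ENNReal.ofReal (2 * L) * ‖𝓕 ψ s‖ₑ ^ 2 := by
        rw [lintegral_const_mul' _ _ ENNReal.ofReal_ne_top, lintegral_lintegral_swap hmeas.aemeasurable]
        congr 1
        refine lintegral_congr fun s => ?_
        -- Bounded overlap: each frequency `s` is seen only by those `t` within `L` of `-s`, a set
        -- of measure `2 L`.
        have : ∀ t, (Metric.closedBall (-t) L).indicator (fun s => ‖𝓕 ψ s‖ₑ ^ 2) s =
            (Metric.closedBall (-s) L).indicator (fun _ => ‖𝓕 ψ s‖ₑ ^ 2) t := fun t => by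
          have : s ∈ Metric.closedBall (-t) L ↔ t ∈ Metric.closedBall (-s) L := by
            simp only [Metric.mem_closedBall, Real.dist_eq, sub_neg_eq_add, add_comm]
          by_cases hs : s ∈ Metric.closedBall (-t) L
          · rw [Set.indicator_of_mem hs, Set.indicator_of_mem (this.1 hs)]
          · rw [Set.indicator_of_notMem hs, Set.indicator_of_notMem (fun h => hs (this.2 h))]
        simp_rw [this]
        rw [lintegral_indicator Metric.isClosed_closedBall.measurableSet, setLIntegral_const,
          Real.volume_closedBall, mul_comm]
    _ = ENNReal.ofReal (16 * B ^ 2 * L ^ 2) * ∫⁻ y, ‖ψ y‖ₑ ^ 2 := by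
        rw [lintegral_const_mul' _ _ ENNReal.ofReal_ne_top, ← mul_assoc,
          lintegral_enorm_fourier_sq hψ hψ₂, ← ENNReal.ofReal_mul
            (by have := ha.L_pos; positivity)]
        congr 2
        ring
    _ ≤ _ := by
        gcongr with y
        rw [enorm_mul, mul_pow, mul_comm, ← ofReal_norm (d y)⁻¹, norm_inv,
          ← ENNReal.ofReal_pow (by positivity), inv_pow]
        gcongr
        exact hd1 y

end IsBumpFamily

lemma IsBumpFamily.stronglyMeasurable_integral {a : ℝ → ℝ → ℂ} {B L : ℝ} (ha : IsBumpFamily a B L)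
    {f : ℝ → ℂ} (hf : Integrable f) :
    StronglyMeasurable fun z : ℝ × ℝ => ∫ y, f y * 𝓕 (a z.2) (y - z.1) := by
  simp_rw [fun z : ℝ × ℝ => integral_mul_fourier_sub hf (ha.integrable z.2) z.1]
  refine StronglyMeasurable.integral_prod_right' (f := fun w : (ℝ × ℝ) × ℝ =>
    𝓕 f w.2 * (a w.1.2 w.2 * Complex.exp (2 * π * Complex.I * w.1.1 * w.2))) ?_
  have h1 := continuous_fourier hf
  have h2 : Continuous fun w : (ℝ × ℝ) × ℝ => a w.1.2 w.2 :=
    ha.continuous.comp (by fun_prop : Continuous fun w : (ℝ × ℝ) × ℝ => (w.1.2, w.2))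
  exact ((h1.comp continuous_snd).mul (h2.mul (by fun_prop))).stronglyMeasurable

/-- Interpolation with respect to the measure of density `1 / (1 + (y - x)^2)`. The kernel decay is
exactly an `L¹ → L^∞` bound for this measure, and the almost orthogonality is the `L²` bound for the
same measure. -/
theorem IsBumpFamily.lintegral_integral_rpow_le {a : ℝ → ℝ → ℂ} {B L p q : ℝ}
    (ha : IsBumpFamily a B L) (hpq : p.HolderConjugate q) (hp : 2 < p) {f : ℝ → ℂ}
    (hfm : Measurable f) (hf : Integrable f) (hf₂ : MemLp f 2) (x : ℝ) :
    ∫⁻ t, ‖∫ y, f y * 𝓕 (a t) (y - x)‖ₑ ^ p ≤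
      ENNReal.ofReal (interpolationConst p (4 * L * B) (16 * B ^ 2 * L ^ 2)) *
        (∫⁻ y, ‖f y‖ₑ ^ q * ENNReal.ofReal ((1 + (y - x) ^ 2)⁻¹)) ^ (p - 1) := by
  have hB := ha.B_pos
  have hL := ha.L_pos
  have hw : Measurable fun y : ℝ => ENNReal.ofReal ((1 + (y - x) ^ 2)⁻¹) := by fun_prop
  have hint : ∀ A : Set ℝ, MeasurableSet A → ∀ t,
      Integrable fun y => A.indicator f y * 𝓕 (a t) (y - x) := fun A hA t =>
    (hf.indicator hA).mul_bdd (c := 2 * L * B)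
      ((continuous_fourier (ha.integrable t)).comp (by fun_prop)).aestronglyMeasurable
      (.of_forall fun y => by simpa using ha.norm_fourier_iteratedDeriv_le (Nat.zero_le 2) t (y - x))
  have key := lintegral_rpow_le_of_truncation
    (μ := volume.withDensity fun y : ℝ => ENNReal.ofReal ((1 + (y - x) ^ 2)⁻¹))
    (ν := volume) (A₁ := 4 * L * B) (A₂ := 16 * B ^ 2 * L ^ 2) hpq hp
    (by positivity) (by positivity) hfm
    (fun A t => ∫ y, A.indicator f y * 𝓕 (a t) (y - x))
    (fun A hA => ((ha.stronglyMeasurable_integral (hf.indicator hA)).measurable.comp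
      (by fun_prop : Measurable fun t : ℝ => (x, t))).aemeasurable)
    (fun A hA t => by
      rw [← integral_add (hint A hA t) (hint Aᶜ hA.compl t)]
      refine integral_congr_ae (.of_forall fun y => ?_)
      simp only [Set.indicator_univ]
      rw [← add_mul]
      congr 1
      exact (congrFun (Set.indicator_self_add_compl A f) y).symm)
    (fun A hA t => by
      rw [restrict_withDensity hA, lintegral_withDensity_eq_lintegral_mul _ hw hfm.enorm,
        ← lintegral_indicator hA, ← lintegral_const_mul' _ _ ENNReal.ofReal_ne_top]
      refine (enorm_integral_le_lintegral_enorm _).trans (lintegral_mono fun y => ?_)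
      by_cases hy : y ∈ A
      · simp only [Set.indicator_of_mem hy, Pi.mul_apply, enorm_mul]
        rw [← mul_assoc, mul_comm, ← ENNReal.ofReal_mul (by positivity)]
        gcongr
        rw [← ofReal_norm]
        exact ENNReal.ofReal_le_ofReal (ha.norm_fourier_le t _)
      · simp [Set.indicator_of_notMem hy])
    (fun A hA => by
      rw [restrict_withDensity hA,
        lintegral_withDensity_eq_lintegral_mul _ hw (hfm.enorm.pow_const 2),
        ← lintegral_indicator hA]
      refine (ha.lintegral_integral_sq_le (hf.indicator hA) (hf₂.indicator hA) x).trans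
        (le_of_eq ?_)
      congr 1
      refine lintegral_congr fun y => ?_
      by_cases hy : y ∈ A
      · simp only [Set.indicator_of_mem hy, Pi.mul_apply]
        rw [mul_comm]
      · simp [Set.indicator_of_notMem hy])
  rw [lintegral_withDensity_eq_lintegral_mul _ hw (by fun_prop)] at key
  simp only [Set.indicator_univ, Pi.mul_apply] at key
  simp_rw [mul_comm (‖f _‖ₑ ^ q)]
  exact key

/-! ### The exponential tail and the mixed norm of the second factor -/

/-- Jensen's inequality for a finite measure with density `w`. -/
lemma lintegral_mul_rpow_le {α : Type*} [MeasurableSpace α] {μ : Measure α} {ρ : ℝ} (hρ : 1 ≤ ρ)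
    {H w : α → ℝ≥0∞} (hH : AEMeasurable H μ) (hw : Measurable w) :
    (∫⁻ x, H x * w x ∂μ) ^ ρ ≤ (∫⁻ x, w x ∂μ) ^ (ρ - 1) * ∫⁻ x, H x ^ ρ * w x ∂μ := by
  rcases hρ.eq_or_lt with rfl | hρ
  · simp
  have hconj := Real.HolderConjugate.conjExponent hρ
  have hH' : AEMeasurable H (μ.withDensity w) := hH.mono_ac (withDensity_absolutelyContinuous _ _)
  have h1 := ENNReal.lintegral_mul_le_Lp_mul_Lq (μ.withDensity w) hconj hH'
    (aemeasurable_const (b := (1 : ℝ≥0∞)))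
  simp only [Pi.mul_apply, mul_one, ENNReal.one_rpow] at h1
  have hρ0 : 0 < ρ := by linarith
  have hρ1 : 0 < ρ - 1 := by linarith
  have h2 := ENNReal.rpow_le_rpow h1 hρ0.le
  rw [ENNReal.mul_rpow_of_nonneg _ _ hρ0.le, ← ENNReal.rpow_mul, ← ENNReal.rpow_mul,
    one_div_mul_cancel hρ0.ne', ENNReal.rpow_one, lintegral_const, one_mul,
    withDensity_apply _ MeasurableSet.univ, Measure.restrict_univ,
    lintegral_withDensity_eq_lintegral_mul₀ hw.aemeasurable hH,
    lintegral_withDensity_eq_lintegral_mul₀ hw.aemeasurable (hH.pow_const ρ)] at h2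
  have e : 1 / ρ.conjExponent * ρ = ρ - 1 := by
    unfold Real.conjExponent
    field_simp
  rw [e, mul_comm] at h2
  simpa only [Pi.mul_apply, mul_comm] using h2

/-- The one-sided exponential `e⁻ˢ`, `s ≥ 0`. -/
noncomputable def expTail (s : ℝ) : ℝ := (Set.Ici 0).indicator (fun s => Real.exp (-s)) s

lemma measurable_expTail : Measurable expTail :=
  Measurable.indicator (by fun_prop) measurableSet_Ici

lemma expTail_nonneg (s : ℝ) : 0 ≤ expTail s := Set.indicator_nonneg (fun _ _ => (exp_pos _).le) s

lemma expTail_le_one (s : ℝ) : expTail s ≤ 1 := by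
  unfold expTail
  by_cases hs : s ∈ Set.Ici (0 : ℝ)
  · rw [Set.indicator_of_mem hs]
    exact Real.exp_le_one_iff.2 (neg_nonpos.2 hs)
  · rw [Set.indicator_of_notMem hs]
    exact zero_le_one

lemma integrable_expTail : Integrable expTail :=
  (integrable_indicator_iff measurableSet_Ici).2
    ((integrableOn_Ici_iff_integrableOn_Ioi (by simp)).2 (integrableOn_exp_neg_Ioi 0))

lemma lintegral_expTail : ∫⁻ s, ENNReal.ofReal (expTail s) = 1 := by
  rw [← ofReal_integral_eq_lintegral_ofReal integrable_expTail (.of_forall expTail_nonneg)]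
  unfold expTail
  rw [integral_indicator measurableSet_Ici, integral_Ici_eq_integral_Ioi,
    integral_exp_neg_Ioi_zero, ENNReal.ofReal_one]

/-- A form of Minkowski's integral inequality in which the bounds `N t` for the slices are given. -/
lemma lintegral_lintegral_rpow_le_of_slice {α β : Type*} [MeasurableSpace α] [MeasurableSpace β]
    {μ : Measure α} {ν : Measure β} [SFinite μ] [SFinite ν] {p q : ℝ} (hpq : p.HolderConjugate q)
    (hp : 2 ≤ p) {F : α → β → ℝ≥0∞} (hF : Measurable (Function.uncurry F)) {N : β → ℝ≥0∞}
    (hN : Measurable N) {C : ℝ≥0∞} (hNfin : ∫⁻ t, N t ∂ν ≠ ∞) (hNtop : ∀ t, N t ≠ ∞)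
    (hN0 : ∀ t, N t = 0 → ∀ x, F x t = 0)
    (hslice : ∀ t, ∫⁻ x, F x t ^ p ∂μ ≤ C * N t ^ (p - 1)) :
    ∫⁻ x, (∫⁻ t, F x t ^ q ∂ν) ^ (p - 1) ∂μ ≤ C * (∫⁻ t, N t ∂ν) ^ (p - 1) := by
  have hp1 : 0 < p - 1 := by linarith
  have hq0 : 0 < q := hpq.symm.pos
  have hqp : q * (p - 1) = p := by have := hpq.mul_eq_add; linarith
  have hFxm : ∀ x, Measurable (F x) := fun x => hF.comp measurable_prodMk_left
  -- Jensen is applied to the measure with density `N`, with exponent `p - 1 ≥ 1`. Since `q (p - 1)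
  -- = p`, the integrand becomes `F ^ p / N ^ (p - 1)`, which the slice bound controls.
  have hsplit : ∀ x t, F x t ^ q = F x t ^ q / N t * N t := fun x t => by
    by_cases h : N t = 0
    · simp [hN0 t h x, hq0]
    · rw [ENNReal.div_mul_cancel h (hNtop t)]
  have hJ : ∀ x, (∫⁻ t, F x t ^ q ∂ν) ^ (p - 1) ≤
      (∫⁻ t, N t ∂ν) ^ (p - 1 - 1) * ∫⁻ t, (F x t ^ q / N t) ^ (p - 1) * N t ∂ν := fun x => by
    rw [lintegral_congr (hsplit x)]
    exact lintegral_mul_rpow_le (by linarith) (((hFxm x).pow_const q).div hN).aemeasurable hN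
  have hmul : (∫⁻ t, N t ∂ν) ^ (p - 1 - 1) * ∫⁻ t, N t ∂ν = (∫⁻ t, N t ∂ν) ^ (p - 1) := by
    nth_rewrite 2 [← ENNReal.rpow_one (∫⁻ t, N t ∂ν)]
    rw [← ENNReal.rpow_add_of_nonneg _ _ (by linarith) zero_le_one]
    congr 1
    ring
  have hjoint : Measurable (Function.uncurry fun x t => (F x t ^ q / N t) ^ (p - 1) * N t) := by
    have : Measurable fun z : α × β => N z.2 := hN.comp measurable_snd
    exact (((hF.pow_const q).div this).pow_const (p - 1)).mul this
  calc _ ≤ ∫⁻ x, (∫⁻ t, N t ∂ν) ^ (p - 1 - 1) *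
          ∫⁻ t, (F x t ^ q / N t) ^ (p - 1) * N t ∂ν ∂μ :=
        lintegral_mono hJ
    _ = (∫⁻ t, N t ∂ν) ^ (p - 1 - 1) *
          ∫⁻ t, ∫⁻ x, (F x t ^ q / N t) ^ (p - 1) * N t ∂μ ∂ν := by
        rw [lintegral_const_mul', lintegral_lintegral_swap hjoint.aemeasurable]
        exact ENNReal.rpow_ne_top_of_nonneg (by linarith) hNfin
    _ ≤ (∫⁻ t, N t ∂ν) ^ (p - 1 - 1) * ∫⁻ t, C * N t ∂ν := by
        gcongr with t
        by_cases h : N t = 0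
        · simp [h]
        rw [lintegral_mul_const' _ _ (hNtop t)]
        gcongr
        simp_rw [ENNReal.div_rpow_of_nonneg _ _ hp1.le, ← ENNReal.rpow_mul, hqp, div_eq_mul_inv]
        rw [lintegral_mul_const', ← div_eq_mul_inv]
        · exact ENNReal.div_le_of_le_mul (hslice t)
        · rw [Ne, ENNReal.inv_eq_top, ENNReal.rpow_eq_zero_iff]
          simp [h, hNtop t]
    _ = C * (∫⁻ t, N t ∂ν) ^ (p - 1) := by
        rw [lintegral_const_mul _ hN, ← hmul]
        ring

lemma norm_expTail_le_one (s : ℝ) : ‖(expTail s : ℂ)‖ ≤ 1 := by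
  rw [Complex.norm_real, norm_of_nonneg (expTail_nonneg s)]
  exact expTail_le_one s

/-- As `0 ≤ expTail ≤ 1` and `q ≥ 1`, its `q`-th power is at most itself, and its integral is `1`.
-/
lemma lintegral_lintegral_mul_expTail_rpow_le {q : ℝ} (hq : 1 ≤ q) {φ : ℝ → ℂ}
    (hφ : Measurable φ) :
    ∫⁻ t : ℝ, ∫⁻ ξ, ‖φ ξ * expTail (ξ - t)‖ₑ ^ q ≤ ∫⁻ ξ, ‖φ ξ‖ₑ ^ q := by
  have hm := measurable_expTail
  have hq0 : 0 ≤ q := by linarith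
  rw [lintegral_lintegral_swap (Measurable.aemeasurable (by unfold Function.uncurry; fun_prop))]
  refine lintegral_mono fun ξ => ?_
  calc ∫⁻ t : ℝ, ‖φ ξ * expTail (ξ - t)‖ₑ ^ q
      ≤ ∫⁻ t : ℝ, ‖φ ξ‖ₑ ^ q * ENNReal.ofReal (expTail (ξ - t)) := by
        refine lintegral_mono fun t => ?_
        rw [enorm_mul, ENNReal.mul_rpow_of_nonneg _ _ hq0]
        gcongr
        rw [← ofReal_norm, Complex.norm_real, norm_of_nonneg (expTail_nonneg _),
          ENNReal.ofReal_rpow_of_nonneg (expTail_nonneg _) hq0]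
        exact ENNReal.ofReal_le_ofReal
          (rpow_le_self_of_le_one (expTail_nonneg _) (expTail_le_one _) hq)
    _ = ‖φ ξ‖ₑ ^ q := by
        rw [lintegral_const_mul _ (by fun_prop),
          lintegral_sub_left_eq_self (fun s => ENNReal.ofReal (expTail s)) ξ,
          lintegral_expTail, mul_one]

lemma measurable_mul_expTail {φ : ℝ → ℂ} (hφ : Measurable φ) :
    Measurable fun z : ℝ × ℝ => φ z.2 * expTail (z.2 - z.1) := by
  have hm := measurable_expTail
  fun_prop

lemma stronglyMeasurable_fourier_mul_expTail {φ : ℝ → ℂ} (hφ : Measurable φ) :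
    StronglyMeasurable fun z : ℝ × ℝ => 𝓕 (fun ξ => φ ξ * expTail (ξ - z.2)) z.1 := by
  simp_rw [Real.fourier_real_eq_integral_exp_smul]
  refine StronglyMeasurable.integral_prod_right' (f := fun w : (ℝ × ℝ) × ℝ =>
    Complex.exp (((-2 * π * w.2 * w.1.1 : ℝ) : ℂ) * Complex.I) •
      (φ w.2 * expTail (w.2 - w.1.2))) ?_
  have h₁ : Measurable fun w : (ℝ × ℝ) × ℝ => φ w.2 * expTail (w.2 - w.1.2) :=
    (measurable_mul_expTail hφ).comp
      (by fun_prop : Measurable fun w : (ℝ × ℝ) × ℝ => (w.1.2, w.2))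
  have h₂ : Measurable fun w : (ℝ × ℝ) × ℝ =>
    Complex.exp (((-2 * π * w.2 * w.1.1 : ℝ) : ℂ) * Complex.I) := by fun_prop
  exact (h₂.smul h₁).stronglyMeasurable

/-- Hausdorff–Young bounds each slice in `t`, and the Minkowski-type lemma sums the slices with no
loss in the constant. -/
theorem lintegral_lintegral_fourier_expTail_le {p q : ℝ} (hpq : p.HolderConjugate q) (hp : 2 < p)
    {φ : ℝ → ℂ} (hφ : Measurable φ) (hφ₁ : Integrable φ) (hφ₂ : MemLp φ 2) :
    ∫⁻ x, (∫⁻ t : ℝ, ‖𝓕 (fun ξ => φ ξ * expTail (ξ - t)) x‖ₑ ^ q) ^ (p - 1) ≤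
      ENNReal.ofReal (interpolationConst p 1 1) * (∫⁻ ξ, ‖φ ξ‖ₑ ^ q) ^ (p - 1) := by
  have hp1 : 0 < p - 1 := by linarith
  have hq0 : 0 < q := hpq.symm.pos
  by_cases hfin : ∫⁻ ξ, ‖φ ξ‖ₑ ^ q = ∞
  · rw [hfin, ENNReal.top_rpow_of_pos hp1, ENNReal.mul_top]
    · exact le_top
    · rw [Ne, ENNReal.ofReal_eq_zero, not_le, interpolationConst]
      have : 0 < p - 2 := by linarith
      positivity
  have hNint := lintegral_lintegral_mul_expTail_rpow_le hpq.symm.lt.le hφ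
  have hm : ∀ t : ℝ, Measurable fun ξ => φ ξ * expTail (ξ - t) := fun t =>
    (measurable_mul_expTail hφ).comp measurable_prodMk_left
  have hle : ∀ t ξ : ℝ, ‖φ ξ * expTail (ξ - t)‖ ≤ ‖φ ξ‖ := fun t ξ => by
    rw [norm_mul]
    exact mul_le_of_le_one_right (norm_nonneg _) (norm_expTail_le_one _)
  refine (lintegral_lintegral_rpow_le_of_slice hpq hp.le
    (F := fun x t => ‖𝓕 (fun ξ => φ ξ * expTail (ξ - t)) x‖ₑ)
    (stronglyMeasurable_fourier_mul_expTail hφ).measurable.enorm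
    (N := fun t => ∫⁻ ξ, ‖φ ξ * expTail (ξ - t)‖ₑ ^ q)
    (((measurable_mul_expTail hφ).enorm.pow_const q).lintegral_prod_right')
    (ne_top_of_le_ne_top hfin hNint) (fun t => ?_) (fun t ht x => ?_) (fun t => ?_)).trans
      (by gcongr)
  · refine ne_top_of_le_ne_top hfin (lintegral_mono fun ξ => ?_)
    gcongr
    exact enorm_le_iff_norm_le.2 (hle t ξ)
  · rw [lintegral_eq_zero_iff ((hm t).enorm.pow_const q)] at ht
    have : ∫⁻ ξ, ‖φ ξ * expTail (ξ - t)‖ₑ = 0 := by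
      rw [lintegral_eq_zero_iff (hm t).enorm]
      filter_upwards [ht] with ξ hξ
      rw [Pi.zero_apply, ENNReal.rpow_eq_zero_iff_of_pos hq0] at hξ
      exact hξ
    exact nonpos_iff_eq_zero.1 ((enorm_fourier_le _ _).trans this.le)
  · exact lintegral_enorm_fourier_rpow_le hpq hp (hm t)
      (hφ₁.mono (hm t).aestronglyMeasurable (.of_forall (hle t)))
      (hφ₂.of_le (hm t).aestronglyMeasurable (.of_forall (hle t)))

/-! ### Poisson averages and Hölder's inequality in `x` -/

/-- The average of `g` against the translate by `x` of `1 / (1 + y ^ 2)` is bounded on `L^ρ`. -/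
lemma lintegral_poisson_rpow_le {ρ : ℝ} (hρ : 1 ≤ ρ) {g : ℝ → ℝ≥0∞} (hg : Measurable g) :
    ∫⁻ x, (∫⁻ y, g y * ENNReal.ofReal ((1 + (y - x) ^ 2)⁻¹)) ^ ρ ≤
      ENNReal.ofReal π ^ ρ * ∫⁻ y, g y ^ ρ := by
  have hπ : ∫⁻ y : ℝ, ENNReal.ofReal ((1 + y ^ 2)⁻¹) = ENNReal.ofReal π := by
    rw [← ofReal_integral_eq_lintegral_ofReal integrable_inv_one_add_sq
      (.of_forall fun y => by positivity), integral_univ_inv_one_add_sq]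
  have hl : ∀ x : ℝ, ∫⁻ y : ℝ, ENNReal.ofReal ((1 + (y - x) ^ 2)⁻¹) = ENNReal.ofReal π := fun x => by
    rw [lintegral_sub_right_eq_self (fun s : ℝ => ENNReal.ofReal ((1 + s ^ 2)⁻¹)) x, hπ]
  have hr : ∀ y : ℝ, ∫⁻ x : ℝ, ENNReal.ofReal ((1 + (y - x) ^ 2)⁻¹) = ENNReal.ofReal π := fun y => by
    rw [lintegral_sub_left_eq_self (fun s : ℝ => ENNReal.ofReal ((1 + s ^ 2)⁻¹)) y, hπ]
  calc _ ≤ ∫⁻ x, ENNReal.ofReal π ^ (ρ - 1) *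
        ∫⁻ y, g y ^ ρ * ENNReal.ofReal ((1 + (y - x) ^ 2)⁻¹) := by
        refine lintegral_mono fun x => ?_
        rw [← hl x]
        exact lintegral_mul_rpow_le hρ hg.aemeasurable (by fun_prop)
    _ = ENNReal.ofReal π ^ (ρ - 1) * (ENNReal.ofReal π * ∫⁻ y, g y ^ ρ) := by
        rw [lintegral_const_mul', lintegral_lintegral_swap]
        · congr 1
          rw [← lintegral_const_mul' _ _ ENNReal.ofReal_ne_top]
          refine lintegral_congr fun y => ?_
          rw [lintegral_const_mul _ (by fun_prop), hr, mul_comm]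
        · exact Measurable.aemeasurable (by unfold Function.uncurry; fun_prop)
        · exact ENNReal.rpow_ne_top_of_nonneg (by linarith) ENNReal.ofReal_ne_top
    _ = _ := by
        rw [← mul_assoc]
        nth_rewrite 2 [← ENNReal.rpow_one (ENNReal.ofReal π)]
        rw [← ENNReal.rpow_add_of_nonneg _ _ (by linarith) zero_le_one, sub_add_cancel]

lemma lintegral_poisson_le_eLpNorm_top {f : ℝ → ℂ} {q : ℝ} (hq : 0 ≤ q) (x : ℝ) :
    ∫⁻ y, ‖f y‖ₑ ^ q * ENNReal.ofReal ((1 + (y - x) ^ 2)⁻¹) ≤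
      eLpNorm f ∞ volume ^ q * ENNReal.ofReal π := by
  calc _ ≤ ∫⁻ y, eLpNorm f ∞ volume ^ q * ENNReal.ofReal ((1 + (y - x) ^ 2)⁻¹) := by
        refine lintegral_mono_ae ?_
        filter_upwards [ae_le_eLpNormEssSup (f := f) (μ := volume)] with y hy
        rw [eLpNorm_exponent_top]
        gcongr
    _ = _ := by
        rw [lintegral_const_mul _ (by fun_prop),
          lintegral_sub_right_eq_self (fun s : ℝ => ENNReal.ofReal ((1 + s ^ 2)⁻¹)) x,
          ← ofReal_integral_eq_lintegral_ofReal integrable_inv_one_add_sq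
          (.of_forall fun y => by positivity), integral_univ_inv_one_add_sq]

/-- Hölder's inequality for a product of a function dominated by `W ^ (1 / q)`, `W` the Poisson
average of `|f| ^ q`, and a function in `L^p`. -/
lemma eLpNorm_le_of_le_poisson_mul {p q : ℝ} (hpq : p.HolderConjugate q) {p₁ : ℝ≥0∞}
    (hp₁ : p₁⁻¹ + (ENNReal.ofReal p)⁻¹ < 1) {f : ℝ → ℂ} (hf : Measurable f) {T : ℝ → ℂ}
    {V : ℝ → ℝ≥0∞} (hV : Measurable V) {K : ℝ≥0∞}
    (hT : ∀ x, ‖T x‖ₑ ≤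
      K * (∫⁻ y, ‖f y‖ₑ ^ q * ENNReal.ofReal ((1 + (y - x) ^ 2)⁻¹)) ^ (1 / q) * V x) :
    eLpNorm T (p₁⁻¹ + (ENNReal.ofReal p)⁻¹)⁻¹ volume ≤
      K * ENNReal.ofReal π ^ (1 / q) * eLpNorm f p₁ volume * (∫⁻ x, V x ^ p) ^ (1 / p) := by
  have hp0 : 0 < p := hpq.pos
  have hq0 : 0 < q := hpq.symm.pos
  -- At `p₁ = ∞` the Poisson average is bounded pointwise and no Hölder inequality in `x` is needed.
  rcases eq_or_ne p₁ ∞ with rfl | hp₁top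
  · rw [ENNReal.inv_top, zero_add, inv_inv, eLpNorm_eq_lintegral_rpow_enorm_toReal
      (by simpa using hp0) ENNReal.ofReal_ne_top, ENNReal.toReal_ofReal hp0.le]
    have hb : ∀ x, ‖T x‖ₑ ≤ K * ENNReal.ofReal π ^ (1 / q) * eLpNorm f ∞ volume * V x := fun x => by
      refine (hT x).trans ?_
      rw [mul_assoc K (_ ^ _) (eLpNorm f ∞ volume)]
      gcongr
      refine (ENNReal.rpow_le_rpow (lintegral_poisson_le_eLpNorm_top hq0.le x)
        (by positivity)).trans (le_of_eq ?_)
      rw [ENNReal.mul_rpow_of_nonneg _ _ (by positivity), ← ENNReal.rpow_mul,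
        mul_one_div_cancel hq0.ne', ENNReal.rpow_one, mul_comm]
    calc _ ≤ (∫⁻ x, (K * ENNReal.ofReal π ^ (1 / q) * eLpNorm f ∞ volume) ^ p * V x ^ p) ^
            (1 / p) := by
          gcongr with x
          rw [← ENNReal.mul_rpow_of_nonneg _ _ hp0.le]
          exact ENNReal.rpow_le_rpow (hb x) hp0.le
      _ = _ := by
          rw [lintegral_const_mul _ (hV.pow_const p), ENNReal.mul_rpow_of_nonneg _ _ (by positivity),
            ← ENNReal.rpow_mul, mul_one_div_cancel hp0.ne', ENNReal.rpow_one]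
  have hp₁0 : p₁ ≠ 0 := by
    rintro rfl
    simp at hp₁
  set s := p₁.toReal with hs
  have hs0 : 0 < s := ENNReal.toReal_pos hp₁0 hp₁top
  have hps : p₁ = ENNReal.ofReal s := (ENNReal.ofReal_toReal hp₁top).symm
  rw [hps, ← ENNReal.ofReal_inv_of_pos hs0, ← ENNReal.ofReal_inv_of_pos hp0,
    ← ENNReal.ofReal_add (by positivity) (by positivity), ← ENNReal.ofReal_one,
    ENNReal.ofReal_lt_ofReal_iff one_pos] at hp₁
  rw [hps, ← ENNReal.ofReal_inv_of_pos hs0, ← ENNReal.ofReal_inv_of_pos hp0,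
    ← ENNReal.ofReal_add (by positivity) (by positivity),
    ← ENNReal.ofReal_inv_of_pos (by positivity)]
  set r := (s⁻¹ + p⁻¹)⁻¹ with hr
  have hr0 : 0 < r := by positivity
  have hrs : 1 / r = 1 / s + 1 / p := by rw [hr]; simp
  have hrs' : r < s := by
    rw [hr, inv_lt_comm₀ (by positivity) hs0]
    have : 0 < p⁻¹ := by positivity
    linarith
  -- The condition `1/p₁ + 1/p < 1` enters here: it gives `s > q`, so averaging `|f| ^ q` acts on an
  -- `L^ρ` with `ρ ≥ 1`.
  have hsq : 1 ≤ s / q := by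
    rw [one_le_div hq0]
    have h1 := hpq.inv_add_inv_eq_one
    have : s⁻¹ < q⁻¹ := by linarith
    exact ((inv_lt_inv₀ hs0 hq0).1 this).le
  rw [eLpNorm_eq_lintegral_rpow_enorm_toReal (by simpa using hr0) ENNReal.ofReal_ne_top,
    eLpNorm_eq_lintegral_rpow_enorm_toReal (by simpa using hs0) ENNReal.ofReal_ne_top,
    ENNReal.toReal_ofReal hr0.le, ENNReal.toReal_ofReal hs0.le]
  set W : ℝ → ℝ≥0∞ := fun x => ∫⁻ y, ‖f y‖ₑ ^ q * ENNReal.ofReal ((1 + (y - x) ^ 2)⁻¹) with hW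
  have hWm : Measurable W := Measurable.lintegral_prod_right'
    (f := fun z : ℝ × ℝ => ‖f z.2‖ₑ ^ q * ENNReal.ofReal ((1 + (z.2 - z.1) ^ 2)⁻¹)) (by fun_prop)
  have hWs : (∫⁻ x, (K * W x ^ (1 / q)) ^ s) ^ (1 / s) ≤
      K * ENNReal.ofReal π ^ (1 / q) * (∫⁻ y, ‖f y‖ₑ ^ s) ^ (1 / s) := by
    have h1 := lintegral_poisson_rpow_le hsq (hf.enorm.pow_const q)
    have e : ∀ x, (K * W x ^ (1 / q)) ^ s = K ^ s * W x ^ (s / q) := fun x => by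
      rw [ENNReal.mul_rpow_of_nonneg _ _ hs0.le, ← ENNReal.rpow_mul, one_div_mul_eq_div]
    simp_rw [← ENNReal.rpow_mul, mul_div_cancel₀ s hq0.ne'] at h1
    simp_rw [e]
    rw [lintegral_const_mul _ (hWm.pow_const _)]
    refine (ENNReal.rpow_le_rpow (mul_le_mul_right h1 _) (by positivity)).trans (le_of_eq ?_)
    rw [ENNReal.mul_rpow_of_nonneg _ _ (by positivity),
      ENNReal.mul_rpow_of_nonneg _ _ (by positivity), ← ENNReal.rpow_mul, ← ENNReal.rpow_mul,
      mul_one_div_cancel hs0.ne', ENNReal.rpow_one, mul_assoc]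
    congr 3
    field_simp
  calc _ ≤ (∫⁻ x, ((fun x => K * W x ^ (1 / q)) * V) x ^ r) ^ (1 / r) := by
        gcongr with x
        exact hT x
    _ ≤ (∫⁻ x, (K * W x ^ (1 / q)) ^ s) ^ (1 / s) * (∫⁻ x, V x ^ p) ^ (1 / p) :=
        ENNReal.lintegral_Lp_mul_le_Lq_mul_Lr hr0 hrs' hrs _
          ((hWm.pow_const _).const_mul K).aemeasurable hV.aemeasurable
    _ ≤ _ := by gcongr

/-- Hölder in `t` at each `x` bounds the integral by the Poisson factor times `V (-x)`; Hölder in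
`x` then combines them. The constant is chosen before `f` and `φ`. -/
theorem IsBumpFamily.eLpNorm_integral_mul_le {a : ℝ → ℝ → ℂ} {B L p q : ℝ}
    (ha : IsBumpFamily a B L) (hpq : p.HolderConjugate q) (hp : 2 < p) {p₁ : ℝ≥0∞}
    (hp₁ : p₁⁻¹ + (ENNReal.ofReal p)⁻¹ < 1) : ∃ C : ℝ≥0, ∀ f φ : ℝ → ℂ, Measurable f →
    Integrable f → MemLp f 2 → Measurable φ → Integrable φ → MemLp φ 2 →
    eLpNorm (fun x => ∫ t : ℝ, (∫ y, f y * 𝓕 (a t) (y - x)) *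
      𝓕 (fun ξ => φ ξ * expTail (ξ - t)) (-x)) (p₁⁻¹ + (ENNReal.ofReal p)⁻¹)⁻¹ volume ≤
      C * eLpNorm f p₁ volume * eLpNorm φ (ENNReal.ofReal q) volume := by
  have hp0 : 0 < p := hpq.pos
  have hq0 : 0 < q := hpq.symm.pos
  have hpq1 : (p - 1) * (1 / p) = 1 / q := by
    have := hpq.inv_add_inv_eq_one
    field_simp at this ⊢
    linarith
  have hpq2 : 1 / q * p = p - 1 := by
    rw [← hpq1]; field_simp
  set K₁ : ℝ≥0∞ := ENNReal.ofReal (interpolationConst p (4 * L * B) (16 * B ^ 2 * L ^ 2)) ^ (1 / p)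
  set K₂ : ℝ≥0∞ := ENNReal.ofReal (interpolationConst p 1 1) ^ (1 / p)
  have hK₁ : K₁ ≠ ∞ := ENNReal.rpow_ne_top_of_nonneg (by positivity) ENNReal.ofReal_ne_top
  have hK₂ : K₂ ≠ ∞ := ENNReal.rpow_ne_top_of_nonneg (by positivity) ENNReal.ofReal_ne_top
  have hKπ : ENNReal.ofReal π ^ (1 / q) ≠ ∞ :=
    ENNReal.rpow_ne_top_of_nonneg (by positivity) ENNReal.ofReal_ne_top
  refine ⟨(K₁ * ENNReal.ofReal π ^ (1 / q) * K₂).toNNReal,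
    fun f φ hfm hf hf₂ hφm hφ hφ₂ => ?_⟩
  rw [ENNReal.coe_toNNReal (by finiteness)]
  set V : ℝ → ℝ≥0∞ := fun x => (∫⁻ t : ℝ, ‖𝓕 (fun ξ => φ ξ * expTail (ξ - t)) x‖ₑ ^ q) ^ (1 / q)
    with hVdef
  have hjoint := (stronglyMeasurable_fourier_mul_expTail hφm).measurable
  have hVm : Measurable V :=
    ((hjoint.enorm.pow_const q).lintegral_prod_right').pow_const _
  have hV : (∫⁻ x, V (-x) ^ p) ^ (1 / p) ≤ K₂ * eLpNorm φ (ENNReal.ofReal q) volume := by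
    rw [(Measure.measurePreserving_neg (volume : Measure ℝ)).lintegral_comp (hVm.pow_const p)]
    simp_rw [hVdef, ← ENNReal.rpow_mul, hpq2]
    refine (ENNReal.rpow_le_rpow (lintegral_lintegral_fourier_expTail_le hpq hp hφm hφ hφ₂)
      (by positivity)).trans (le_of_eq ?_)
    rw [eLpNorm_eq_lintegral_rpow_enorm_toReal (by simpa using hq0) ENNReal.ofReal_ne_top,
      ENNReal.toReal_ofReal hq0.le, ENNReal.mul_rpow_of_nonneg _ _ (by positivity),
      ← ENNReal.rpow_mul, hpq1]
  have hT : ∀ x, ‖∫ t : ℝ, (∫ y, f y * 𝓕 (a t) (y - x)) *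
      𝓕 (fun ξ => φ ξ * expTail (ξ - t)) (-x)‖ₑ ≤
      K₁ * (∫⁻ y, ‖f y‖ₑ ^ q * ENNReal.ofReal ((1 + (y - x) ^ 2)⁻¹)) ^ (1 / q) * V (-x) := fun x => by
    have hG : Measurable fun t => ‖∫ y, f y * 𝓕 (a t) (y - x)‖ₑ :=
      ((ha.stronglyMeasurable_integral hf).measurable.comp
        (by fun_prop : Measurable fun t : ℝ => (x, t))).enorm
    have hF : Measurable fun t : ℝ => ‖𝓕 (fun ξ => φ ξ * expTail (ξ - t)) (-x)‖ₑ :=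
      (hjoint.comp (by fun_prop : Measurable fun t : ℝ => (-x, t))).enorm
    refine (enorm_integral_le_lintegral_enorm _).trans ?_
    simp_rw [enorm_mul]
    refine (ENNReal.lintegral_mul_le_Lp_mul_Lq volume hpq hG.aemeasurable hF.aemeasurable).trans ?_
    gcongr
    refine (ENNReal.rpow_le_rpow (ha.lintegral_integral_rpow_le hpq hp hfm hf hf₂ x)
      (by positivity)).trans (le_of_eq ?_)
    rw [ENNReal.mul_rpow_of_nonneg _ _ (by positivity), ← ENNReal.rpow_mul, hpq1]
  refine (eLpNorm_le_of_le_poisson_mul hpq hp₁ hfm (hVm.comp measurable_neg) hT).trans ?_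
  calc _ ≤ K₁ * ENNReal.ofReal π ^ (1 / q) * eLpNorm f p₁ volume *
        (K₂ * eLpNorm φ (ENNReal.ofReal q) volume) := by gcongr; exact hV
    _ = _ := by ring

/-! ### From the symbol to a bump family -/

lemma abs_add_le_infDist_antidiagonal (ξ : EuclideanSpace ℝ (Fin 2)) :
    |ξ 0 + ξ 1| ≤ 2 * Metric.infDist ξ antidiagonal := by
  have hne : (antidiagonal).Nonempty := ⟨0, by simp [antidiagonal]⟩
  have : |ξ 0 + ξ 1| / 2 ≤ Metric.infDist ξ antidiagonal := by
    refine (Metric.le_infDist hne).2 fun y hy => ?_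
    have hy' : y 0 + y 1 = 0 := hy
    have h0 := PiLp.norm_apply_le (ξ - y) 0
    have h1 := PiLp.norm_apply_le (ξ - y) 1
    rw [PiLp.sub_apply, Real.norm_eq_abs] at h0 h1
    have h2 : ξ 0 + ξ 1 = (ξ 0 - y 0) + (ξ 1 - y 1) := by linarith
    rw [dist_eq_norm, h2]
    have := abs_add_le (ξ 0 - y 0) (ξ 1 - y 1)
    linarith
  linarith

/-- At points of the line `m` vanishes on a neighbourhood, so smoothness off the line extends across
it. -/
lemma contDiff_of_contDiffOn_compl_antidiagonal {m : EuclideanSpace ℝ (Fin 2) → ℂ} {n : ℕ∞}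
    (hm : ContDiffOn ℝ n m antidiagonalᶜ) {c : ℝ} (hc : 0 < c)
    (hsupp : ∀ ξ, Metric.infDist ξ antidiagonal < c → m ξ = 0) : ContDiff ℝ n m := by
  have hcl : IsClosed antidiagonal := isClosed_eq (by fun_prop) continuous_const
  refine contDiff_iff_contDiffAt.2 fun ξ => ?_
  by_cases h : ξ ∈ antidiagonal
  · have hd : Metric.infDist ξ antidiagonal < c := by
      rwa [Metric.infDist_zero_of_mem h]
    have hev : m =ᶠ[nhds ξ] fun _ => 0 := by
      filter_upwards [(Metric.continuous_infDist_pt antidiagonal).continuousAt.eventually_lt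
        continuousAt_const hd] with η hη using hsupp η hη
    exact contDiffAt_const.congr_of_eventuallyEq hev
  · exact hm.contDiffAt (hcl.isOpen_compl.mem_nhds h)

lemma contDiff_vec_two {n : ℕ∞} :
    ContDiff ℝ n fun z : ℝ × ℝ => (!₂[z.1, z.2] : EuclideanSpace ℝ (Fin 2)) := by
  rw [contDiff_euclidean]
  intro i
  fin_cases i
  · exact contDiff_fst
  · exact contDiff_snd

/-- The family `m + ∂₂ m` of functions of the first variable, from which `m` is recovered by
integration against `expTail`. -/
noncomputable def bumpFamily (m : EuclideanSpace ℝ (Fin 2) → ℂ) (t s : ℝ) : ℂ :=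
  m !₂[s, t] + deriv (fun t => m !₂[s, t]) t

section BumpFamily

variable {m : EuclideanSpace ℝ (Fin 2) → ℂ}

lemma bumpFamily_eq_zero {U : Set (EuclideanSpace ℝ (Fin 2))} (hU : IsOpen U)
    (hm : ∀ ξ ∈ U, m ξ = 0) {t s : ℝ} (h : !₂[s, t] ∈ U) : bumpFamily m t s = 0 := by
  have hc : Continuous fun t : ℝ => (!₂[s, t] : EuclideanSpace ℝ (Fin 2)) :=
    (contDiff_vec_two (n := 0)).continuous.comp (by fun_prop : Continuous fun t : ℝ => (s, t))
  have hev : (fun t => m !₂[s, t]) =ᶠ[nhds t] fun _ => 0 := by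
    filter_upwards [(hU.preimage hc).mem_nhds h] with t' ht' using hm _ ht'
  rw [bumpFamily, hm _ h, hev.deriv_eq, deriv_const, add_zero]

lemma deriv_snd_eq_fderiv (hm : ContDiff ℝ 3 m) (s t : ℝ) :
    deriv (fun t => m !₂[s, t]) t =
      fderiv ℝ (fun z : ℝ × ℝ => m !₂[z.1, z.2]) (s, t) (0, 1) := by
  have h1 : ContDiff ℝ 3 fun z : ℝ × ℝ => m !₂[z.1, z.2] := hm.comp (contDiff_vec_two (n := 3))
  have h2 : HasDerivAt (fun t : ℝ => (s, t)) ((0 : ℝ), (1 : ℝ)) t :=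
    (hasDerivAt_const t s).prodMk (hasDerivAt_id t)
  exact ((h1.differentiable (by norm_num) (s, t)).hasFDerivAt.comp_hasDerivAt t h2).deriv

lemma contDiff_deriv_snd (hm : ContDiff ℝ 3 m) :
    ContDiff ℝ 2 fun z : ℝ × ℝ => deriv (fun t => m !₂[z.1, t]) z.2 := by
  simp_rw [deriv_snd_eq_fderiv hm]
  have h1 : ContDiff ℝ 3 fun z : ℝ × ℝ => m !₂[z.1, z.2] := hm.comp (contDiff_vec_two (n := 3))
  exact (h1.fderiv_right (m := 2) (by norm_num)).clm_apply contDiff_const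

lemma contDiff_bumpFamily (hm : ContDiff ℝ 3 m) :
    ContDiff ℝ 2 fun z : ℝ × ℝ => bumpFamily m z.2 z.1 := by
  have h1 : ContDiff ℝ 3 fun z : ℝ × ℝ => m !₂[z.1, z.2] := hm.comp (contDiff_vec_two (n := 3))
  exact (h1.of_le (by norm_num)).add (contDiff_deriv_snd hm)

lemma iteratedDeriv_bumpFamily (hm : ContDiff ℝ 3 m) {j : ℕ} (hj : j ≤ 2) (t s : ℝ) :
    iteratedDeriv j (bumpFamily m t) s =
      mixedPartial j 0 m !₂[s, t] + mixedPartial j 1 m !₂[s, t] := by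
  have h1 : ContDiff ℝ 2 fun z : ℝ × ℝ => m !₂[z.1, z.2] :=
    (hm.comp (contDiff_vec_two (n := 3))).of_le (by norm_num)
  have hst : ContDiff ℝ 2 fun s : ℝ => (s, t) := contDiff_id.prodMk contDiff_const
  have hj' : (j : WithTop ℕ∞) ≤ 2 := by exact_mod_cast hj
  have h2 := ((h1.comp hst).of_le hj').contDiffAt (x := s)
  have h3 := (((contDiff_deriv_snd hm).comp hst).of_le hj').contDiffAt (x := s)
  simp only [mixedPartial, iteratedDeriv_zero, iteratedDeriv_one]
  exact iteratedDeriv_add h2 h3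

/-- At distance at least `c` from the line the symbol bounds are uniform; closer in, everything
vanishes. Two derivatives in `s` of `m + ∂₂m` cost three derivatives of `m`. -/
theorem IsSymbol.exists_isBumpFamily (hm : IsSymbol 3 m) (hs : SupportedAtUnitDistance m) :
    ContDiff ℝ 3 m ∧ ∃ B L, IsBumpFamily (bumpFamily m) B L := by
  obtain ⟨c, C, hc, hsupp⟩ := hs
  have hlt : ∀ ξ, Metric.infDist ξ antidiagonal < c → m ξ = 0 := fun ξ hξ => by
    by_contra h
    exact absurd (hsupp ξ h).1 (not_le.2 hξ)
  have hgt : ∀ ξ, C < Metric.infDist ξ antidiagonal → m ξ = 0 := fun ξ hξ => by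
    by_contra h
    exact absurd (hsupp ξ h).2 (not_le.2 hξ)
  have hsm : ContDiff ℝ 3 m := contDiff_of_contDiffOn_compl_antidiagonal (n := 3) hm.1 hc hlt
  refine ⟨hsm, ?_⟩
  have hd := Metric.continuous_infDist_pt antidiagonal
  have hex : ∀ j : Fin 3, ∀ b : Fin 2, ∃ K : ℝ, ∀ ξ : EuclideanSpace ℝ (Fin 2),
      c ≤ Metric.infDist ξ antidiagonal → ‖mixedPartial j b m ξ‖ ≤ K := fun j b => by
    obtain ⟨K, hK⟩ := hm.2 j b (by omega)
    refine ⟨K / c ^ ((j : ℕ) + b), fun ξ hξ => ?_⟩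
    rw [le_div_iff₀ (by positivity), mul_comm]
    refine le_trans ?_ (hK ξ)
    gcongr
  choose K hK using hex
  have hKle : ∀ j b, |K j b| ≤ ∑ j, ∑ b, |K j b| := fun j b =>
    (Finset.single_le_sum (f := fun b => |K j b|) (fun _ _ => abs_nonneg _) (Finset.mem_univ b)).trans
      (Finset.single_le_sum (f := fun j => ∑ b, |K j b|)
        (fun _ _ => Finset.sum_nonneg fun _ _ => abs_nonneg _) (Finset.mem_univ j))
  have hS : 0 ≤ ∑ j, ∑ b, |K j b| := (abs_nonneg _).trans (hKle 0 0)
  -- The factor `2` in `B` counts the summands `m` and `∂₂m`; the one in `L` converts distance to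
  -- the line into `|s + t|`. `C` may be negative if `m = 0`, hence `|C|`; adding `1` ensures
  -- positivity.
  refine ⟨2 * ∑ j, ∑ b, |K j b| + 1, 2 * |C| + 1, by positivity, by positivity, fun t => ?_, ?_,
    fun j hj t s => ?_, fun t s hts => ?_⟩
  · exact (contDiff_bumpFamily hsm).comp
      (contDiff_id.prodMk contDiff_const : ContDiff ℝ 2 fun s : ℝ => (s, t))
  · exact (contDiff_bumpFamily hsm).continuous.comp continuous_swap
  · by_cases h : Metric.infDist !₂[s, t] antidiagonal < c
    · have hU : IsOpen {ξ : EuclideanSpace ℝ (Fin 2) | Metric.infDist ξ antidiagonal < c} :=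
        isOpen_lt hd continuous_const
      have hcs : Continuous fun s : ℝ => (!₂[s, t] : EuclideanSpace ℝ (Fin 2)) :=
        (contDiff_vec_two (n := 0)).continuous.comp (by fun_prop : Continuous fun s : ℝ => (s, t))
      have hev : bumpFamily m t =ᶠ[nhds s] fun _ => 0 := by
        filter_upwards [(hU.preimage hcs).mem_nhds h] with s' hs'
        exact bumpFamily_eq_zero hU hlt hs'
      rw [hev.iteratedDeriv_eq]
      have : iteratedDeriv j (fun _ : ℝ => (0 : ℂ)) s = 0 := by
        simp
      rw [this, norm_zero]
      positivity
    · rw [iteratedDeriv_bumpFamily hsm hj]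
      have h0 := (hK ⟨j, by omega⟩ 0 _ (not_lt.1 h)).trans ((le_abs_self _).trans (hKle _ _))
      have h1 := (hK ⟨j, by omega⟩ 1 _ (not_lt.1 h)).trans ((le_abs_self _).trans (hKle _ _))
      simp only [Fin.val_zero, Fin.val_one] at h0 h1
      refine (norm_add_le _ _).trans ?_
      linarith
  · by_contra! h
    refine hts (bumpFamily_eq_zero (isOpen_lt continuous_const hd) hgt ?_)
    have := abs_add_le_infDist_antidiagonal !₂[s, t]
    simp only [Matrix.cons_val_zero, Matrix.cons_val_one] at this
    show C < _
    linarith [le_abs_self C]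

/-- The fundamental theorem of calculus on `(-∞, ξ]` for `e^(t - ξ) m(s, t)`, which is compactly
supported in `t` and equals `m(s, ξ)` at `t = ξ`. -/
lemma integral_expTail_mul_bumpFamily (hm : ContDiff ℝ 3 m)
    (hs : ∃ R, ∀ s t : ℝ, m !₂[s, t] ≠ 0 → |s + t| ≤ R) (s ξ : ℝ) :
    ∫ t, expTail (ξ - t) * bumpFamily m t s = m !₂[s, ξ] := by
  obtain ⟨R, hR⟩ := hs
  have hu : ContDiff ℝ 1 fun t : ℝ => m !₂[s, t] :=
    ((hm.comp (contDiff_vec_two (n := 3))).of_le (by norm_num)).comp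
      (contDiff_const.prodMk contDiff_id : ContDiff ℝ 1 fun t : ℝ => (s, t))
  let g : ℝ → ℂ := fun t => Complex.exp (t - ξ) * m !₂[s, t]
  have hexp : ContDiff ℝ 1 fun t : ℝ => Complex.exp (t - ξ) :=
    (Complex.ofRealCLM.contDiff.sub contDiff_const).cexp
  have hg : ContDiff ℝ 1 g := hexp.mul hu
  have hgc : HasCompactSupport g := by
    refine HasCompactSupport.intro (isCompact_closedBall (-s) R) fun t ht => ?_
    have : m !₂[s, t] = 0 := by
      by_contra h
      refine ht ?_
      rw [Metric.mem_closedBall, Real.dist_eq, sub_neg_eq_add, add_comm]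
      exact hR s t h
    simp [g, this]
  have hderiv : ∀ t, deriv g t = Complex.exp (t - ξ) * bumpFamily m t s := fun t => by
    have h1 : HasDerivAt (fun t : ℝ => Complex.exp (t - ξ)) (Complex.exp (t - ξ)) t := by
      have := ((Complex.ofRealCLM.hasDerivAt (x := t)).sub_const (ξ : ℂ)).cexp
      simpa using this
    have h2 := (hu.differentiable one_ne_zero t).hasDerivAt
    have h3 : deriv g t = _ := (h1.mul h2).deriv
    rw [h3, bumpFamily]
    ring
  have key := hgc.integral_Iic_deriv_eq hg ξ
  rw [← integral_indicator measurableSet_Iic] at key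
  have hgξ : g ξ = m !₂[s, ξ] := by simp [g]
  rw [← hgξ, ← key]
  refine integral_congr_ae (.of_forall fun t => ?_)
  by_cases ht : t ≤ ξ
  · simp only [expTail]
    rw [Set.indicator_of_mem (Set.mem_Iic.2 ht), Set.indicator_of_mem (by simpa using ht), hderiv]
    push_cast
    congr 2
    ring
  · simp only [expTail]
    rw [Set.indicator_of_notMem (by simpa using ht), Set.indicator_of_notMem (by simpa using ht)]
    simp

end BumpFamily

/-! ### Separation of variables in the bilinear operator -/

lemma integral_euclideanSpace_two (F : EuclideanSpace ℝ (Fin 2) → ℂ) :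
    ∫ ξ, F ξ = ∫ z : ℝ × ℝ, F !₂[z.1, z.2] := by
  have h1 := (EuclideanSpace.volume_preserving_symm_measurableEquiv_toLp (Fin 2)).symm
  have h2 := (volume_preserving_finTwoArrow ℝ).symm
  have h3 := h1.comp h2
  rw [← h3.integral_comp ((MeasurableEquiv.measurableEmbedding _).comp
    (MeasurableEquiv.measurableEmbedding _))]
  rfl

/-- Integrating the norm in `t` first gives `|g₁| |g₂|`, since `expTail` has mass `1`. This
dominates the triple integral in the Fubini step. -/
lemma integrable_prod_mul_expTail {g₁ g₂ : ℝ → ℂ} (h₁ : Integrable g₁) (h₂ : Integrable g₂) :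
    Integrable fun w : (ℝ × ℝ) × ℝ => g₁ w.1.1 * g₂ w.1.2 * (expTail (w.1.2 - w.2) : ℂ) := by
  have hE := measurable_expTail
  have h12 : Integrable fun z : ℝ × ℝ => g₁ z.1 * g₂ z.2 := h₁.mul_prod h₂
  have hm : AEStronglyMeasurable
      (fun w : (ℝ × ℝ) × ℝ => g₁ w.1.1 * g₂ w.1.2 * (expTail (w.1.2 - w.2) : ℂ)) volume := by
    refine (h12.1.comp_fst (ν := (volume : Measure ℝ))).mul ?_
    exact Measurable.aestronglyMeasurable (by fun_prop)
  have hEi : ∀ ξ : ℝ, Integrable fun t => expTail (ξ - t) := fun ξ =>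
    integrable_expTail.comp_sub_left ξ
  have hE1 : ∫ s, expTail s = 1 := by
    rw [integral_eq_lintegral_of_nonneg_ae (.of_forall expTail_nonneg) hE.aestronglyMeasurable,
      lintegral_expTail, ENNReal.toReal_one]
  refine (integrable_prod_iff hm).2 ⟨.of_forall fun z => ?_, ?_⟩
  · exact (Integrable.ofReal (𝕜 := ℂ) (hEi z.2)).const_mul (g₁ z.1 * g₂ z.2)
  · refine h12.norm.congr (.of_forall fun z => ?_)
    simp only [norm_mul, Complex.norm_real, norm_of_nonneg (expTail_nonneg _)]
    rw [integral_const_mul, integral_sub_left_eq_self (fun s => expTail s), hE1, mul_one]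

/-- After the superposition formula for `m` and Fubini, the integrand at fixed `t` is a product in
`ξ₁` and `ξ₂`. The `ξ₁` integral becomes a kernel integral against `f₁`; the `ξ₂` integral is a
Fourier transform at `-x`. -/
theorem bilinearMultiplier_eq_integral {m : EuclideanSpace ℝ (Fin 2) → ℂ} {B L : ℝ}
    (ha : IsBumpFamily (bumpFamily m) B L) (hm : ContDiff ℝ 3 m)
    (hs : ∃ R, ∀ s t : ℝ, m !₂[s, t] ≠ 0 → |s + t| ≤ R) (f₁ f₂ : 𝓢(ℝ, ℂ)) (x : ℝ) :
    bilinearMultiplier m f₁ f₂ x = ∫ t : ℝ, (∫ y, f₁ y * 𝓕 (bumpFamily m t) (y - x)) *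
      𝓕 (fun ξ => 𝓕 (f₂ : ℝ → ℂ) ξ * expTail (ξ - t)) (-x) := by
  set e : ℝ → ℂ := fun s => Complex.exp (2 * π * Complex.I * x * s) with he
  set g₁ : ℝ → ℂ := 𝓕 (f₁ : ℝ → ℂ) with hg₁
  set g₂ : ℝ → ℂ := 𝓕 (f₂ : ℝ → ℂ) with hg₂
  have hi₁ : Integrable g₁ := by rw [hg₁, ← SchwartzMap.fourier_coe]; exact (𝓕 f₁).integrable
  have hi₂ : Integrable g₂ := by rw [hg₂, ← SchwartzMap.fourier_coe]; exact (𝓕 f₂).integrable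
  have hec : Continuous e := by fun_prop
  let Φ : ℝ × ℝ → ℝ → ℂ := fun z t =>
    (g₁ z.1 * (bumpFamily m t z.1 * e z.1)) * (g₂ z.2 * expTail (z.2 - t) * e z.2)
  have hΦ : Integrable (Function.uncurry Φ) := by
    have hbd : ∀ w : (ℝ × ℝ) × ℝ, ‖bumpFamily m w.2 w.1.1 * (e w.1.1 * e w.1.2)‖ ≤ B := fun w => by
      rw [norm_mul, norm_mul, norm_cexp_two_pi_I_mul, norm_cexp_two_pi_I_mul, mul_one, mul_one]
      simpa using ha.bound 0 (Nat.zero_le 2) w.2 w.1.1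
    have hcont : Continuous fun w : (ℝ × ℝ) × ℝ => bumpFamily m w.2 w.1.1 * (e w.1.1 * e w.1.2) :=
      (ha.continuous.comp (by fun_prop : Continuous fun w : (ℝ × ℝ) × ℝ => (w.2, w.1.1))).mul
        (by fun_prop)
    refine ((integrable_prod_mul_expTail hi₁ hi₂).mul_bdd hcont.aestronglyMeasurable
      (.of_forall hbd)).congr (.of_forall fun w => ?_)
    simp only [Φ, Function.uncurry]
    ring
  calc bilinearMultiplier m f₁ f₂ x = ∫ z : ℝ × ℝ, ∫ t, Φ z t := by
        rw [bilinearMultiplier, integral_euclideanSpace_two]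
        refine integral_congr_ae (.of_forall fun z => ?_)
        simp only [Matrix.cons_val_zero, Matrix.cons_val_one]
        rw [← integral_expTail_mul_bumpFamily hm hs z.1 z.2, mul_add, Complex.exp_add,
          mul_assoc, mul_assoc,
          ← integral_mul_const]
        refine integral_congr_ae (.of_forall fun t => ?_)
        simp only [Φ, he]
        ring
    _ = ∫ t, ∫ z : ℝ × ℝ, Φ z t := integral_integral_swap hΦ
    _ = _ := by
        refine integral_congr_ae (.of_forall fun t => ?_)
        simp only [Φ]
        refine (integral_prod_mul (μ := (volume : Measure ℝ)) (ν := (volume : Measure ℝ))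
          (fun s => g₁ s * (bumpFamily m t s * e s))
          (fun ξ => g₂ ξ * expTail (ξ - t) * e ξ)).trans ?_
        rw [integral_mul_fourier_sub f₁.integrable (ha.integrable t) x]
        congr 1
        rw [Real.fourier_real_eq_integral_exp_smul]
        refine integral_congr_ae (.of_forall fun ξ => ?_)
        simp only [he, smul_eq_mul]
        rw [mul_comm]
        congr 2
        push_cast
        ring

/-! ### Measurability and conclusion -/

lemma IsBumpFamily.stronglyMeasurable_integral_mul {a : ℝ → ℝ → ℂ} {B L : ℝ}
    (ha : IsBumpFamily a B L) {f φ : ℝ → ℂ} (hf : Integrable f) (hφ : Measurable φ) :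
    StronglyMeasurable fun x => ∫ t : ℝ, (∫ y, f y * 𝓕 (a t) (y - x)) *
      𝓕 (fun ξ => φ ξ * expTail (ξ - t)) (-x) := by
  have h₁ : Measurable fun z : ℝ × ℝ => ∫ y, f y * 𝓕 (a z.2) (y - z.1) :=
    (ha.stronglyMeasurable_integral hf).measurable
  have hn : Measurable fun z : ℝ × ℝ => (-z.1, z.2) := by fun_prop
  have h₂ := (stronglyMeasurable_fourier_mul_expTail hφ).measurable.comp hn
  exact StronglyMeasurable.integral_prod_right' (f := fun z : ℝ × ℝ =>
    (∫ y, f y * 𝓕 (a z.2) (y - z.1)) * 𝓕 (fun ξ => φ ξ * expTail (ξ - z.2)) (-z.1))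
    (h₁.mul h₂).stronglyMeasurable

lemma ENNReal.conjExponent_ofReal {p q : ℝ} (hpq : p.HolderConjugate q) :
    ENNReal.conjExponent (ENNReal.ofReal p) = ENNReal.ofReal q := by
  have hp : 0 < p - 1 := sub_pos.2 hpq.lt
  rw [ENNReal.conjExponent, ← ENNReal.ofReal_one, ← ENNReal.ofReal_sub _ zero_le_one,
    ← ENNReal.ofReal_inv_of_pos hp, ← ENNReal.ofReal_add zero_le_one (by positivity),
    hpq.conjugate_eq]
  congr 1
  field_simp
  ring

theorem proposition11 :
    ∃ N : ℕ, ∀ m₀ : EuclideanSpace ℝ (Fin 2) → ℂ,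
      IsSymbol N m₀ → SupportedAtUnitDistance m₀ →
        ∀ p₁ p₂ : ℝ≥0∞, p₁⁻¹ + p₂⁻¹ < 1 → 2 < p₂ → p₂ < ∞ →
          MixedEstimate (bilinearMultiplier m₀) p₁ p₂ := by
  -- `N = 3`: one derivative in `ξ₂` for the superposition and two in `ξ₁` for the kernel decay.
  refine ⟨3, fun m hm hs p₁ p₂ h12 h2 htop => ?_⟩
  obtain ⟨hsm, B, L, ha⟩ := hm.exists_isBumpFamily hs
  have hsupp : ∃ R, ∀ s t : ℝ, m !₂[s, t] ≠ 0 → |s + t| ≤ R := by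
    obtain ⟨c, C, -, h⟩ := hs
    refine ⟨2 * C, fun s t hst => ?_⟩
    have h1 := abs_add_le_infDist_antidiagonal !₂[s, t]
    simp only [Matrix.cons_val_zero, Matrix.cons_val_one] at h1
    linarith [(h _ hst).2]
  obtain ⟨p, rfl⟩ : ∃ p, p₂ = ENNReal.ofReal p := ⟨_, (ENNReal.ofReal_toReal htop.ne).symm⟩
  have hp : 2 < p := by
    rwa [← ENNReal.ofReal_ofNat, ENNReal.ofReal_lt_ofReal_iff_of_nonneg zero_le_two] at h2
  obtain ⟨q, hpq⟩ : ∃ q, p.HolderConjugate q :=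
    ⟨_, Real.HolderConjugate.conjExponent (one_lt_two.trans hp)⟩
  obtain ⟨C, hC⟩ := ha.eLpNorm_integral_mul_le hpq hp h12
  refine ⟨C, fun f₁ f₂ => ?_⟩
  have hfun : bilinearMultiplier m f₁ f₂ = _ :=
    funext (bilinearMultiplier_eq_integral ha hsm hsupp f₁ f₂)
  obtain ⟨g, hF⟩ : ∃ g : 𝓢(ℝ, ℂ), (g : ℝ → ℂ) = 𝓕 (f₂ : ℝ → ℂ) :=
    ⟨𝓕 f₂, SchwartzMap.fourier_coe f₂⟩
  have hfp : MemLp f₁ p₁ volume := f₁.memLp p₁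
  have hgq : MemLp g (ENNReal.ofReal q) volume := g.memLp _
  have hle := hC f₁ g f₁.continuous.measurable f₁.integrable (f₁.memLp 2)
    g.continuous.measurable g.integrable (g.memLp 2)
  rw [hF, ← hfun] at hle
  have hw : eLpNorm (𝓕 (f₂ : ℝ → ℂ)) (ENNReal.ofReal q) volume =
      wNorm (ENNReal.ofReal p) f₂ := by
    rw [wNorm, ENNReal.conjExponent_ofReal hpq]
  have hfin : wNorm (ENNReal.ofReal p) f₂ ≠ ∞ := by
    rw [← hw, ← hF]
    exact hgq.eLpNorm_lt_top.ne
  rw [hw] at hle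
  refine ⟨⟨?_, hle.trans_lt ?_⟩, hle⟩
  · rw [hfun, ← hF]
    exact (ha.stronglyMeasurable_integral_mul f₁.integrable
      g.continuous.measurable).aestronglyMeasurable
  · exact ENNReal.mul_lt_top (ENNReal.mul_lt_top ENNReal.coe_lt_top hfp.eLpNorm_lt_top)
      hfin.lt_top
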